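/- Let $M$ be an oriented matroid on a finite linearly ordered ground set $E$, and let $t(M;x,y)$ be the Tutte polynomial of its underlying matroid. Identify the reorientations $-_AM$ of $M$ with the subsets $A\subseteq E$. If $C$ is (the support of) a positive circuit, resp. positive cocircuit, of $-_AM$, say that $-_{C\triangle A}M$ is obtained from $-_AM$ by a circuit, resp. cocircuit, reversal. The circuit-cocircuit reversal classes are the classes of the equivalence relation on reorientations generated by all circuit and cocircuit reversals; the circuit, resp. cocircuit, reversal classes are those of the equivalence relation generated by circuit, resp. cocircuit, reversals only. A reorientation $-_AM$ is acyclic if it has no positive circuit, and totally cyclic if every element of $E$ lies in a positive circuit of it; a reversal class is acyclic (resp. totally cyclic) if all its members are. A reorientation $-_AM$ is circuit minimal (resp. cocircuit minimal) if $A$ does not contain the minimum element of any positive circuit (resp. positive cocircuit) of $-_AM$, and circuit-cocircuit minimal if it is both. Then: 1. The number of circuit-cocircuit reversal classes is at most $t(M;1,1)$, with equality if and only if no two distinct circuit-cocircuit minimal reorientations are contained in the same circuit-cocircuit reversal class. 2. The number of cocircuit reversal classes is at most $t(M;1,2)$, with equality if and only if no two distinct cocircuit minimal reorientations are contained in the same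 cocircuit reversal class. 3. The number of circuit reversal classes is at most $t(M;2,1)$, with equality if and only if no two distinct circuit minimal reorientations are contained in the same circuit reversal class. 4. The number of acyclic cocircuit reversal classes is at most $t(M;1,0)$, with equality if and only if no two distinct acyclic cocircuit minimal reorientations are contained in the same cocircuit reversal class. The same holds with "circuit-cocircuit" in place of "cocircuit" throughout. 5. The number of totally cyclic circuit reversal classes is at most $t(M;0,1)$, with equality if and only if no two distinct totally cyclic circuit minimal reorientations are contained in the same circuit reversal class. The same holds with "circuit-cocircuit" in place of "circuit" throughout. -/

import Mathlib

open scoped symmDiff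

/-- An oriented matroid on the ground set `E`, given by its signed circuits. A signed subset of `E`
is a function `X : E → SignType`, with `X⁺ = {e | X e = 1}` and `X⁻ = {e | X e = -1}`; its support
(the underlying unsigned set) is `Function.support X`. -/
structure OrientedMatroid (E : Type*) where
  /-- The set of signed circuits. -/
  circuits : Set (E → SignType)
  zero_notMem : (0 : E → SignType) ∉ circuits
  neg_mem : ∀ X ∈ circuits, -X ∈ circuits
  incomparable : ∀ X ∈ circuits, ∀ Y ∈ circuits,
    Function.support X ⊆ Function.support Y → X = Y ∨ X = -Y
  /-- Weak elimination: if `X ≠ -Y` and `e ∈ X⁺ ∩ Y⁻`, there is a circuit `Z` with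
  `Z⁺ ⊆ (X⁺ ∪ Y⁺) \ {e}` and `Z⁻ ⊆ (X⁻ ∪ Y⁻) \ {e}`. -/
  elimination : ∀ X ∈ circuits, ∀ Y ∈ circuits, X ≠ -Y → ∀ e, X e = 1 → Y e = -1 →
    ∃ Z ∈ circuits, Z e = 0 ∧
      (∀ f, Z f = 1 → X f = 1 ∨ Y f = 1) ∧ (∀ f, Z f = -1 → X f = -1 ∨ Y f = -1)

/-- Two signed sets are orthogonal if their supports are disjoint, or if they agree in sign on some
common element and have opposite signs on another. -/
def SignOrthogonal {E : Type*} (X Y : E → SignType) : Prop :=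
  (∀ e, X e * Y e = 0) ∨ ((∃ e, X e * Y e = 1) ∧ ∃ f, X f * Y f = -1)

/-- The signed set with empty negative part and positive part `C`. -/
def positiveVector {E : Type*} [DecidableEq E] (C : Finset E) : E → SignType :=
  fun e => if e ∈ C then 1 else 0

/-- The signed set obtained from `X` by reversing the signs on `A`. -/
def signReverse {E : Type*} [DecidableEq E] (A : Finset E) (X : E → SignType) : E → SignType :=
  fun e => if e ∈ A then -X e else X e

theorem signReverse_neg {E : Type*} [DecidableEq E] (A : Finset E) (X : E → SignType) :
    signReverse A (-X) = -signReverse A X := by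
  funext e; simp only [signReverse, Pi.neg_apply]; split <;> rfl

theorem signReverse_signReverse {E : Type*} [DecidableEq E] (A : Finset E) (X : E → SignType) :
    signReverse A (signReverse A X) = X := by
  funext e; by_cases h : e ∈ A <;> simp [signReverse, h]

theorem support_signReverse {E : Type*} [DecidableEq E] (A : Finset E) (X : E → SignType) :
    Function.support (signReverse A X) = Function.support X := by
  ext e
  by_cases h : e ∈ A
  · cases hX : X e <;> simp [signReverse, h, hX]
  · simp [signReverse, h]

namespace OrientedMatroid

variable {E : Type*}

/-- Elimination on unsigned circuits. -/
theorem support_elimination (M : OrientedMatroid E) {X Y : E → SignType} (hX : X ∈ M.circuits)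
    (hY : Y ∈ M.circuits) (hne : Function.support X ≠ Function.support Y) {e : E}
    (heX : X e ≠ 0) (heY : Y e ≠ 0) :
    ∃ Z ∈ M.circuits, Z e = 0 ∧ ∀ f, Z f ≠ 0 → X f ≠ 0 ∨ Y f ≠ 0 := by
  have key : ∀ X ∈ M.circuits, ∀ Y ∈ M.circuits, Function.support X ≠ Function.support Y →
      X e = 1 → Y e = -1 → ∃ Z ∈ M.circuits, Z e = 0 ∧ ∀ f, Z f ≠ 0 → X f ≠ 0 ∨ Y f ≠ 0 := by
    intro X hX Y hY hne h1 h2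
    have hXY : X ≠ -Y := by
      rintro rfl
      exact hne (by ext f; cases h : Y f <;> simp [h])
    obtain ⟨Z, hZ, hZe, hp, hm⟩ := M.elimination X hX Y hY hXY e h1 h2
    refine ⟨Z, hZ, hZe, fun f hf => ?_⟩
    have h3 : Z f = 1 ∨ Z f = -1 := by
      revert hf; cases Z f <;> decide
    rcases h3 with h | h
    · rcases hp f h with h | h <;> simp [h]
    · rcases hm f h with h | h <;> simp [h]
  have hneg : ∀ Z : E → SignType, Function.support (-Z) = Function.support Z := by
    intro Z; ext f; cases h : Z f <;> simp [h]
  have hz : ∀ s : SignType, -s ≠ 0 ↔ s ≠ 0 := by decide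
  have hs : ∀ s : SignType, s ≠ 0 → s = 1 ∨ s = -1 := by decide
  rcases hs _ heX with h1 | h1 <;> rcases hs _ heY with h2 | h2
  · simpa [hz] using key X hX (-Y) (M.neg_mem Y hY) (by rwa [hneg]) h1 (by simp [h2])
  · exact key X hX Y hY hne h1 h2
  · simpa [hz] using key (-X) (M.neg_mem X hX) (-Y) (M.neg_mem Y hY) (by rwa [hneg, hneg])
      (by simp [h1]) (by simp [h2])
  · simpa [hz] using key (-X) (M.neg_mem X hX) Y hY (by rwa [hneg]) (by simp [h1]) h2

/-- A set is independent if it contains no support of a signed circuit. -/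
def IndepFinset (M : OrientedMatroid E) (I : Finset E) : Prop :=
  ∀ X ∈ M.circuits, ¬ Function.support X ⊆ (I : Set E)

theorem indepFinset_empty (M : OrientedMatroid E) : M.IndepFinset ∅ := by
  intro X hX hs
  have h0 : X = 0 := Function.support_eq_empty_iff.1 (Set.subset_empty_iff.1 (by simpa using hs))
  exact M.zero_notMem (h0 ▸ hX)

theorem IndepFinset.subset {M : OrientedMatroid E} {I J : Finset E} (hJ : M.IndepFinset J)
    (h : I ⊆ J) : M.IndepFinset I :=
  fun X hX hs => hJ X hX (hs.trans (by exact_mod_cast h))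

theorem IndepFinset.augment [DecidableEq E] {M : OrientedMatroid E} {I J : Finset E}
    (hI : M.IndepFinset I) (hJ : M.IndepFinset J) (hIJ : I.card < J.card) :
    ∃ e ∈ J, e ∉ I ∧ M.IndepFinset (insert e I) := by
  classical
  let P : ℕ → Prop := fun n =>
    ∃ K : Finset E, K ⊆ I ∪ J ∧ M.IndepFinset K ∧ I.card < K.card ∧ (I \ K).card = n
  have hP : ∃ n, P n := ⟨_, J, Finset.subset_union_right, hJ, hIJ, rfl⟩
  obtain ⟨K, hKs, hK, hcard, hn⟩ := Nat.find_spec hP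
  have hmin : ∀ L : Finset E, L ⊆ I ∪ J → I.card < L.card → (I \ L).card < (I \ K).card →
      ¬ M.IndepFinset L := fun L h1 h2 h3 h4 =>
    Nat.find_min hP (hn ▸ h3) ⟨L, h1, h4, h2, rfl⟩
  obtain ⟨g, hgK, hgI⟩ : ∃ g ∈ K, g ∉ I := Finset.exists_mem_notMem_of_card_lt_card hcard
  by_cases hsub : I ⊆ K
  · refine ⟨g, ?_, hgI, hK.subset (Finset.insert_subset hgK hsub)⟩
    rcases Finset.mem_union.1 (hKs hgK) with h | h
    · exact absurd h hgI
    · exact h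
  obtain ⟨e, heI, heK⟩ := Finset.not_subset.1 hsub
  have hdep : ∀ f ∈ K, f ∉ I → ∃ X ∈ M.circuits,
      Function.support X ⊆ ((insert e K).erase f : Finset E) ∧ X e ≠ 0 ∧ X f = 0 := by
    intro f hfK hfI
    have h1 : (insert e K).erase f ⊆ I ∪ J := by
      intro x hx
      rcases Finset.mem_insert.1 (Finset.mem_of_mem_erase hx) with rfl | h
      · exact Finset.mem_union_left _ heI
      · exact hKs h
    have h2 : I.card < ((insert e K).erase f).card := by
      rw [Finset.card_erase_of_mem (Finset.mem_insert_of_mem hfK),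
        Finset.card_insert_of_notMem heK]
      simpa using hcard
    have h3 : (I \ (insert e K).erase f).card < (I \ K).card := by
      apply Finset.card_lt_card
      have hef : e ≠ f := fun h => hfI (h ▸ heI)
      refine Finset.ssubset_iff_of_subset ?_ |>.2 ⟨e, by simp [heI, heK], by simp [hef]⟩
      intro x hx
      simp only [Finset.mem_sdiff, Finset.mem_erase, Finset.mem_insert] at hx ⊢
      refine ⟨hx.1, fun hxK => hx.2 ⟨fun h => hfI (h ▸ hx.1), Or.inr hxK⟩⟩
    have h4 := hmin _ h1 h2 h3
    simp only [IndepFinset, not_forall, not_not] at h4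
    obtain ⟨X, hX, hXs⟩ := h4
    refine ⟨X, hX, hXs, fun hXe => hK X hX fun x hx => ?_, ?_⟩
    · have hx' := hXs hx
      simp only [Finset.coe_erase, Finset.coe_insert, Set.mem_sdiff, Set.mem_insert_iff,
        Finset.mem_coe] at hx'
      rcases hx'.1 with rfl | h
      · exact absurd hXe hx
      · exact h
    · by_contra hXf
      have := hXs (show f ∈ Function.support X from hXf)
      simp at this
  obtain ⟨X, hX, hXs, hXe, hXg⟩ := hdep g hgK hgI
  obtain ⟨f, hfK, hfI, hXf⟩ : ∃ f ∈ K, f ∉ I ∧ X f ≠ 0 := by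
    by_contra hcon
    push Not at hcon
    refine hI X hX fun x hx => ?_
    have hx' := hXs hx
    simp only [Finset.coe_erase, Finset.coe_insert, Set.mem_sdiff, Set.mem_insert_iff,
      Finset.mem_coe] at hx'
    rcases hx'.1 with rfl | h
    · exact heI
    · by_contra hxI
      exact hx (hcon x h hxI)
  obtain ⟨Y, hY, hYs, hYe, hYf⟩ := hdep f hfK hfI
  have hne : Function.support X ≠ Function.support Y := by
    intro h
    have : f ∈ Function.support Y := h ▸ (show f ∈ Function.support X from hXf)
    exact this hYf
  obtain ⟨Z, hZ, hZe, hZs⟩ := M.support_elimination hX hY hne hXe hYe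
  refine absurd (fun x hx => ?_) (hK Z hZ)
  have hxe : x ≠ e := fun h => hx (h ▸ hZe)
  rcases hZs x hx with h | h
  · have := hXs h
    simp only [Finset.coe_erase, Finset.coe_insert, Set.mem_sdiff, Set.mem_insert_iff,
      Finset.mem_coe] at this
    exact this.1.resolve_left hxe
  · have := hYs h
    simp only [Finset.coe_erase, Finset.coe_insert, Set.mem_sdiff, Set.mem_insert_iff,
      Finset.mem_coe] at this
    exact this.1.resolve_left hxe

variable [DecidableEq E]

/-- The underlying matroid: its independent sets are the sets containing no support of a signed
circuit, so its circuits are the supports of the signed circuits. -/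
def toMatroid (M : OrientedMatroid E) [Finite E] : Matroid E :=
  (IndepMatroid.ofFinset Set.univ M.IndepFinset
    M.indepFinset_empty
    (fun _ _ hJ h => hJ.subset h)
    (fun _ _ hI hJ h => hI.augment hJ h)
    (fun _ _ => Set.subset_univ _)).matroid

theorem toMatroid_ground (M : OrientedMatroid E) [Finite E] : M.toMatroid.E = Set.univ := rfl

theorem toMatroid_indep_iff (M : OrientedMatroid E) [Finite E] (I : Finset E) :
    M.toMatroid.Indep I ↔ ∀ X ∈ M.circuits, ¬ Function.support X ⊆ (I : Set E) := by
  rw [toMatroid, IndepMatroid.matroid_Indep, IndepMatroid.ofFinset_indep]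
  rfl

/-- The reorientation `-_A M`: the signs of all circuits are reversed on `A`. -/
def reorient (M : OrientedMatroid E) (A : Finset E) : OrientedMatroid E where
  circuits := {X | signReverse A X ∈ M.circuits}
  zero_notMem h := M.zero_notMem (by
    have : signReverse A (0 : E → SignType) = 0 := by
      funext e; simp [signReverse]
    simpa [this] using h)
  neg_mem X hX := by
    rw [Set.mem_ofPred_eq, signReverse_neg]
    exact M.neg_mem _ hX
  incomparable X hX Y hY h := by
    rcases M.incomparable _ hX _ hY (by simpa only [support_signReverse] using h) with h | h
    · left
      rw [← signReverse_signReverse A X, h, signReverse_signReverse]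
    · right
      rw [← signReverse_signReverse A X, h, signReverse_neg, signReverse_signReverse]
  elimination X hX Y hY hne e hXe hYe := by
    have hne' : signReverse A X ≠ -signReverse A Y := by
      intro h
      apply hne
      rw [← signReverse_signReverse A X, h, signReverse_neg, signReverse_signReverse]
    by_cases he : e ∈ A
    · obtain ⟨Z, hZ, hZe, hp, hm⟩ := M.elimination _ hY _ hX
        (fun h => hne' (by rw [h, neg_neg])) e (by simp [signReverse, he, hYe])
        (by simp [signReverse, he, hXe])
      refine ⟨signReverse A Z, by simpa only [Set.mem_ofPred_eq, signReverse_signReverse],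
        by simp [signReverse, hZe], fun f hf => ?_, fun f hf => ?_⟩ <;>
      · have h1 := hp f
        have h2 := hm f
        revert hf h1 h2
        by_cases hfA : f ∈ A <;> simp only [signReverse, hfA, if_true, if_false] <;>
          generalize X f = a <;> generalize Y f = b <;> generalize Z f = c <;>
          revert a b c <;> decide
    · obtain ⟨Z, hZ, hZe, hp, hm⟩ := M.elimination _ hX _ hY hne' e (by simp [signReverse, he, hXe])
        (by simp [signReverse, he, hYe])
      refine ⟨signReverse A Z, by simpa only [Set.mem_ofPred_eq, signReverse_signReverse],
        by simp [signReverse, hZe], fun f hf => ?_, fun f hf => ?_⟩ <;>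
      · have h1 := hp f
        have h2 := hm f
        revert hf h1 h2
        by_cases hfA : f ∈ A <;> simp only [signReverse, hfA, if_true, if_false] <;>
          generalize X f = a <;> generalize Y f = b <;> generalize Z f = c <;>
          revert a b c <;> decide

variable [Fintype E]

/-- The signed cocircuits (the signed circuits of the dual oriented matroid): the signed sets
supported on a cocircuit of the underlying matroid and orthogonal to all signed circuits. -/
def cocircuits (M : OrientedMatroid E) : Set (E → SignType) :=
  {Y | M.toMatroid.IsCocircuit (Function.support Y) ∧ ∀ X ∈ M.circuits, SignOrthogonal X Y}

/-- `C` is (the support of) a positive circuit of `M`. -/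
def IsPositiveCircuit (M : OrientedMatroid E) (C : Finset E) : Prop :=
  positiveVector C ∈ M.circuits

/-- `C` is (the support of) a positive cocircuit of `M`. -/
def IsPositiveCocircuit (M : OrientedMatroid E) (C : Finset E) : Prop :=
  positiveVector C ∈ M.cocircuits

/-- `M` is acyclic: it has no positive circuit. -/
def IsAcyclic (M : OrientedMatroid E) : Prop := ∀ C, ¬ M.IsPositiveCircuit C

/-- `M` is totally cyclic: every element lies in a positive circuit. -/
def IsTotallyCyclic (M : OrientedMatroid E) : Prop := ∀ e, ∃ C, M.IsPositiveCircuit C ∧ e ∈ C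

/-- `-_B M` is obtained from `-_A M` by reversing a positive circuit of `-_A M`. -/
def CircuitReversal (M : OrientedMatroid E) (A B : Finset E) : Prop :=
  ∃ C, (M.reorient A).IsPositiveCircuit C ∧ B = C ∆ A

/-- `-_B M` is obtained from `-_A M` by reversing a positive cocircuit of `-_A M`. -/
def CocircuitReversal (M : OrientedMatroid E) (A B : Finset E) : Prop :=
  ∃ C, (M.reorient A).IsPositiveCocircuit C ∧ B = C ∆ A

/-- The circuit-cocircuit reversal classes of reorientations of `M`, where the reorientation
`-_A M` is identified with the subset `A`. -/
def circuitCocircuitClasses (M : OrientedMatroid E) : Set (Set (Finset E)) :=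
  (Relation.EqvGen.setoid fun A B => M.CircuitReversal A B ∨ M.CocircuitReversal A B).classes

/-- The circuit reversal classes of reorientations of `M`. -/
def circuitClasses (M : OrientedMatroid E) : Set (Set (Finset E)) :=
  (Relation.EqvGen.setoid M.CircuitReversal).classes

/-- The cocircuit reversal classes of reorientations of `M`. -/
def cocircuitClasses (M : OrientedMatroid E) : Set (Set (Finset E)) :=
  (Relation.EqvGen.setoid M.CocircuitReversal).classes

/-- The members of `𝒦` all of whose elements are acyclic reorientations of `M`. -/
def acyclicPart (M : OrientedMatroid E) (𝒦 : Set (Set (Finset E))) : Set (Set (Finset E)) :=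
  {K ∈ 𝒦 | ∀ A ∈ K, (M.reorient A).IsAcyclic}

/-- The members of `𝒦` all of whose elements are totally cyclic reorientations of `M`. -/
def totallyCyclicPart (M : OrientedMatroid E) (𝒦 : Set (Set (Finset E))) : Set (Set (Finset E)) :=
  {K ∈ 𝒦 | ∀ A ∈ K, (M.reorient A).IsTotallyCyclic}

/-- `-_A M` is circuit minimal: `A` does not contain the minimum of a positive circuit
of `-_A M`. -/
def CircuitMinimal [LinearOrder E] (M : OrientedMatroid E) (A : Finset E) : Prop :=
  ∀ C, (M.reorient A).IsPositiveCircuit C → ∀ e, IsLeast (C : Set E) e → e ∉ A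

/-- `-_A M` is cocircuit minimal: `A` does not contain the minimum of a positive cocircuit
of `-_A M`. -/
def CocircuitMinimal [LinearOrder E] (M : OrientedMatroid E) (A : Finset E) : Prop :=
  ∀ C, (M.reorient A).IsPositiveCocircuit C → ∀ e, IsLeast (C : Set E) e → e ∉ A

/-- At most one reorientation satisfying `P` lies in each member of `𝒦`. -/
def NoTwoInSameClass (P : Finset E → Prop) (𝒦 : Set (Set (Finset E))) : Prop :=
  ∀ K ∈ 𝒦, ∀ A ∈ K, ∀ B ∈ K, P A → P B → A = B

end OrientedMatroid

/-- The rank of a set in a matroid, as a natural number. -/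
noncomputable def matroidRank {E : Type*} (M : Matroid E) (A : Set E) : ℕ := (M.eRk A).toNat

/-- The Tutte polynomial
`t(M; x, y) = ∑ A ⊆ E, (x - 1) ^ (r(E) - r(A)) * (y - 1) ^ (|A| - r(A))`
of a matroid whose ground set is the whole finite type `E`. The inner variable is `x`, the outer
one is `y`. -/
noncomputable def tuttePolynomial {E : Type*} [Fintype E] (M : Matroid E) :
    Polynomial (Polynomial ℤ) :=
  ∑ A : Finset E,
    (Polynomial.C Polynomial.X - 1) ^ (matroidRank M Set.univ - matroidRank M (A : Set E)) *
      (Polynomial.X - 1) ^ (A.card - matroidRank M (A : Set E))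

/-- The value `t(M; x, y)` of the Tutte polynomial of the matroid underlying `M`. -/
noncomputable def OrientedMatroid.tutte {E : Type*} [Fintype E] [DecidableEq E]
    (M : OrientedMatroid E) (x y : ℤ) : ℤ :=
  Polynomial.evalEval x y (tuttePolynomial M.toMatroid)

/-! Two facts give all the bounds and equality criteria. First, every reversal class contains a
minimal reorientation: if `A` contains the minimum of a positive circuit or cocircuit `C`, then `C ∆
A` is lexicographically smaller, so the smallest member of a class is minimal. Sending a minimal `A`
to its class is thus a surjection onto the classes, and equality of cardinalities means injectivity
(`ncard_classes_le_and_eq_iff`). For the acyclic and totally cyclic versions one also needs these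
properties to be constant on classes; this holds because positive circuits and positive cocircuits
are disjoint, so reversing one kind leaves the other kind unchanged.

Second, the minimal reorientations are counted by the Tutte polynomial. Call `e` active in `-_A M`
if it is the minimum of a positive circuit, and dually active if it is the minimum of a positive
cocircuit. Weight each active element by `v` or `y`, and each dually active one by `u` or `x`,
according to whether it lies in `A` or not. The sum over all `A` of the products is `t(M; x + u, y +
v)` (`sum_activityWeight`). With the variables set to 0 or 1 the product becomes the indicator of
the desired kind of minimality, and the sum becomes a count.

The expansion is proved by deletion and contraction of the largest element `n` of a minor. If `n` is
a loop or a coloop of the minor, it only contributes a factor. Otherwise the two orientations of `n`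
have, on the remaining elements, the activities of the deletion in one case and of the contraction
in the other (`activeWith_dichotomy`). To treat both kinds of activity at once, dual activity is
expressed through circuits: by Farkas' lemma (`exists_isPositiveCocircuit`), `e` is not dually
active exactly when some circuit is positive at `e` and nonnegative on all larger elements. Farkas'
lemma and the dichotomy both rest on strong circuit elimination, which is derived from the weak
elimination axiom. -/

namespace OrientedMatroid

/-! ### Strong circuit elimination -/

variable {E : Type*}

/-- Weak elimination, in a form that is symmetric under negation. -/
theorem weak_elimination (M : OrientedMatroid E) {X Y : E → SignType} (hX : X ∈ M.circuits)
    (hY : Y ∈ M.circuits) (hne : X ≠ -Y) {e : E} (he : X e ≠ 0) (heY : Y e = -X e) :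
    ∃ Z ∈ M.circuits, Z e = 0 ∧ ∀ h, Z h = 0 ∨ Z h = X h ∨ Z h = Y h := by
  have key : ∀ a b c : SignType, (c = 1 → a = 1 ∨ b = 1) → (c = -1 → a = -1 ∨ b = -1) →
      c = 0 ∨ c = a ∨ c = b := by decide
  have hs : ∀ s : SignType, s ≠ 0 → s = 1 ∨ s = -1 := by decide
  rcases hs _ he with h1 | h1
  · obtain ⟨Z, hZ, hZe, hp, hm⟩ := M.elimination X hX Y hY hne e h1 (by rw [heY, h1])
    exact ⟨Z, hZ, hZe, fun h => key _ _ _ (hp h) (hm h)⟩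
  · obtain ⟨Z, hZ, hZe, hp, hm⟩ := M.elimination Y hY X hX
      (fun h => hne (by rw [h, neg_neg])) e (by rw [heY, h1]; rfl) h1
    exact ⟨Z, hZ, hZe, fun h => (key _ _ _ (hp h) (hm h)).imp_right Or.symm⟩

/-- The conclusion of strong elimination of `e` from `X` and `Y` while keeping `f`. -/
def EliminatesKeeping (M : OrientedMatroid E) (X Y : E → SignType) (e f : E) : Prop :=
  ∃ Z ∈ M.circuits, Z e = 0 ∧ Z f ≠ 0 ∧ ∀ h, Z h = 0 ∨ Z h = X h ∨ Z h = Y h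

theorem EliminatesKeeping.symm {M : OrientedMatroid E} {X Y : E → SignType} {e f : E}
    (h : M.EliminatesKeeping X Y e f) : M.EliminatesKeeping Y X e f := by
  obtain ⟨Z, hZ, h1, h2, h3⟩ := h
  exact ⟨Z, hZ, h1, h2, fun h => (h3 h).imp_right Or.symm⟩

variable [Finite E]

/-- The inductive step of strong elimination. -/
theorem eliminatesKeeping_step (M : OrientedMatroid E) {X Y : E → SignType}
    (hX : X ∈ M.circuits) (hY : Y ∈ M.circuits) {e f : E} (he : X e ≠ 0) (heY : Y e = -X e)
    (hf : X f ≠ 0) (hfY : Y f ≠ -X f)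
    (ih : ∀ V ∈ M.circuits, ∀ W ∈ M.circuits, (∀ h, V h ≠ 0 ∨ W h ≠ 0 → X h ≠ 0 ∨ Y h ≠ 0) →
      (∃ a, (X a ≠ 0 ∨ Y a ≠ 0) ∧ V a = 0 ∧ W a = 0) → ∀ a b, V a ≠ 0 → W a = -V a →
      V b ≠ 0 → W b ≠ -V b → M.EliminatesKeeping V W a b)
    (ih' : ∀ V ∈ M.circuits, ∀ W ∈ M.circuits, (∀ h, V h ≠ 0 ∨ W h ≠ 0 → X h ≠ 0 ∨ Y h ≠ 0) →
      (Y f = 0 → V f = 0 ∧ W f = 0) → ∀ a b, V a ≠ 0 → W a = -V a →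
      V b ≠ 0 → W b = 0 → M.EliminatesKeeping V W a b) :
    M.EliminatesKeeping X Y e f := by
  classical
  have := Fintype.ofFinite E
  obtain ⟨Z, hZ, hZe, hZs⟩ := M.weak_elimination hX hY
    (fun h => hfY (by rw [h, Pi.neg_apply, neg_neg])) he heY
  by_cases hZf : Z f = 0
  swap
  · exact ⟨Z, hZ, hZe, hZf, hZs⟩
  -- `Z` misses `f`, so by incomparability its support cannot lie inside that of `X`.
  obtain ⟨g, hgZ, hgX⟩ : ∃ g, Z g ≠ 0 ∧ X g = 0 := by
    by_contra! hcon
    rcases M.incomparable Z hZ X hX (fun h hh => hcon h hh) with rfl | rfl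
    · exact hf hZf
    · exact hf (by simpa using hZf)
  have heY0 : Y e ≠ 0 := by rw [heY]; revert he; generalize X e = a; revert a; decide
  -- circuits obtained from `Y` and `±Z` that vanish somewhere on `supp Y \ supp X`
  have hW : ∀ n : ℕ, ∀ W ∈ M.circuits, W e ≠ 0 →
      (∀ h, W h = 0 ∨ W h = Y h ∨ W h = Z h ∨ W h = -Z h) →
      (∃ a, X a = 0 ∧ Y a ≠ 0 ∧ W a = 0) →
      (Finset.univ.filter fun h => X h = 0 ∧ W h ≠ 0 ∧ W h ≠ Y h).card = n →
      ∃ W ∈ M.circuits, W e ≠ 0 ∧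
      (∀ h, W h = 0 ∨ W h = Y h ∨ W h = Z h ∨ W h = -Z h) ∧
      (∃ a, X a = 0 ∧ Y a ≠ 0 ∧ W a = 0) ∧ ∀ h, X h = 0 → W h = 0 ∨ W h = Y h := by
    intro n
    induction n using Nat.strong_induction_on with
    | _ n IH =>
      intro W hW hWe hWs hWa hn
      by_cases hbad : ∃ h, X h = 0 ∧ W h ≠ 0 ∧ W h ≠ Y h
      swap
      · push Not at hbad
        exact ⟨W, hW, hWe, hWs, hWa, fun h hh => or_iff_not_imp_left.2 (hbad h hh)⟩
      obtain ⟨b, hbX, hbW, hbY⟩ := hbad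
      have hbZ : Z b = -W b := by
        have h1 := hZs b; have h2 := hWs b
        revert hbX hbW hbY h1 h2
        generalize X b = x; generalize Y b = y; generalize Z b = z; generalize W b = w
        revert x y z w; decide
      -- A bad sign of `W` is opposite to that of `Z`, so it cancels against `Z`. Since `Z e = 0`,
      -- the element `e` can be kept, and `b` is the new zero on `supp Y \ supp X`.
      obtain ⟨V, hV, hVb, hVe, hVs⟩ := ih' W hW Z hZ (fun h => by
          have h1 := hZs h; have h2 := hWs h
          revert h1 h2
          generalize X h = x; generalize Y h = y; generalize Z h = z; generalize W h = w
          revert x y z w; decide) (fun h => ⟨by simpa [h, hZf] using hWs f, hZf⟩) b e hbW hbZ hWe hZe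
      refine IH _ ?_ V hV hVe (fun h => ?_) ⟨b, hbX, ?_, hVb⟩ rfl
      · rw [← hn]
        apply Finset.card_lt_card
        refine Finset.ssubset_iff_of_subset ?_ |>.2 ⟨b, by simp [*], by simp [*]⟩
        intro h
        simp only [Finset.mem_filter, Finset.mem_univ, true_and]
        have h1 := hZs h; have h2 := hVs h
        revert h1 h2
        generalize X h = x; generalize Y h = y; generalize Z h = z; generalize W h = w
        generalize V h = v
        revert x y z w v; decide
      · have h1 := hWs h; have h2 := hVs h
        revert h1 h2
        generalize Y h = y; generalize Z h = z; generalize W h = w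
        generalize V h = v
        revert y z w v; decide
      · have h1 := hZs b
        revert h1 hbX hbZ hbW
        generalize X b = x; generalize Y b = y; generalize Z b = z; generalize W b = w
        revert x y z w; decide
  have hgY : Y g = Z g := by
    have h1 := hZs g
    revert h1 hgX hgZ
    generalize X g = x; generalize Y g = y; generalize Z g = z
    revert x y z; decide
  -- Replace `Y` by a circuit that still has the sign of `Y` at `e` but vanishes somewhere on `supp
  -- Y \ supp X`. Together with `X` it then has a smaller union of supports.
  obtain ⟨W₀, hW₀, hW₀g, hW₀e, hW₀s⟩ := ih' Y hY (-Z) (M.neg_mem Z hZ) (fun h => by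
      have h1 := hZs h
      rw [Pi.neg_apply]
      revert h1
      generalize X h = x; generalize Y h = y; generalize Z h = z
      revert x y z; decide) (fun h => ⟨h, by simp [hZf]⟩) g e (by rwa [hgY]) (by simp [hgY]) heY0
      (by simp [hZe])
  obtain ⟨W, hW, hWe, hWs, ⟨a, haX, haY, haW⟩, hWX⟩ := hW _ W₀ hW₀ hW₀e
    (fun h => by
      have h1 := hW₀s h
      rw [Pi.neg_apply] at h1
      tauto) ⟨g, hgX, by rwa [hgY], hW₀g⟩ rfl
  have hWe' : W e = Y e := by
    have := hWs e
    simp only [hZe, neg_zero] at this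
    tauto
  obtain ⟨V₀, hV₀, hV₀e, hV₀f, hV₀s⟩ := ih X hX W hW (fun h => by
      have h1 := hZs h; have h2 := hWs h
      revert h1 h2
      generalize X h = x; generalize Y h = y; generalize Z h = z; generalize W h = w
      revert x y z w; decide) ⟨a, Or.inr haY, haX, haW⟩ e f he (by rw [hWe', heY]) hf (by
      have h1 := hWs f
      rw [hZf] at h1
      revert h1 hf hfY
      generalize X f = x; generalize Y f = y; generalize W f = w
      revert x y w; decide)
  -- `V₀` may carry signs of `-Z` that come from neither `X` nor `Y`. They are cancelled against `Z`
  -- one at a time; the induction hypothesis applies because `V` and `Z` both vanish at `e`.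
  have hV : ∀ n : ℕ, ∀ V ∈ M.circuits, V e = 0 → V f ≠ 0 →
      (∀ h, V h = 0 ∨ V h = X h ∨ V h = Y h ∨ V h = -Z h) →
      (Finset.univ.filter fun h => V h ≠ 0 ∧ V h ≠ X h ∧ V h ≠ Y h).card = n →
      M.EliminatesKeeping X Y e f := by
    intro n
    induction n using Nat.strong_induction_on with
    | _ n IH =>
      intro V hV hVe hVf hVs hn
      by_cases hbad : ∃ h, V h ≠ 0 ∧ V h ≠ X h ∧ V h ≠ Y h
      swap
      · push Not at hbad
        exact ⟨V, hV, hVe, hVf, fun h => by have := hbad h; tauto⟩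
      obtain ⟨b, hb0, hbX, hbY⟩ := hbad
      have hbZ : Z b = -V b := by
        have h2 := hVs b
        revert hbX hb0 hbY h2
        generalize X b = x; generalize Y b = y; generalize Z b = z; generalize V b = w
        revert x y z w; decide
      obtain ⟨U, hU, hUb, hUf, hUs⟩ := ih V hV Z hZ (fun h => by
          have h1 := hZs h; have h2 := hVs h
          revert h1 h2
          generalize X h = x; generalize Y h = y; generalize Z h = z; generalize V h = w
          revert x y z w; decide) ⟨e, Or.inl he, hVe, hZe⟩ b f hb0 hbZ hVf (by
            rw [hZf]; revert hVf; generalize V f = v; revert v; decide)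
      refine IH _ ?_ U hU ?_ hUf (fun h => ?_) rfl
      · rw [← hn]
        apply Finset.card_lt_card
        refine Finset.ssubset_iff_of_subset ?_ |>.2 ⟨b, by simp [*], by simp [*]⟩
        intro h
        simp only [Finset.mem_filter, Finset.mem_univ, true_and]
        have h1 := hZs h; have h2 := hUs h
        revert h1 h2
        generalize X h = x; generalize Y h = y; generalize Z h = z; generalize V h = w
        generalize U h = v
        revert x y z w v; decide
      · simpa [hVe, hZe] using hUs e
      · have h0 := hZs h; have h1 := hVs h; have h2 := hUs h
        revert h0 h1 h2
        generalize X h = x; generalize Y h = y; generalize Z h = z; generalize V h = w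
        generalize U h = v
        revert x y z w v; decide
  refine hV _ V₀ hV₀ hV₀e hV₀f (fun h => ?_) rfl
  have h0 := hZs h; have h1 := hWs h; have h2 := hV₀s h
  revert h0 h1 h2
  generalize X h = x; generalize Y h = y; generalize Z h = z; generalize V₀ h = w
  generalize W h = v
  revert x y z w v; decide

/-- Strong induction on the size of the union of the supports, with two layers at each size. If `Y f
= 0`, all auxiliary pairs miss `f` or another element of the union, hence are smaller. In general an
auxiliary pair may have the same union, but then its second circuit vanishes at the element to be
kept, and the first layer (`single`) applies. -/
theorem eliminatesKeeping_of_ne_zero (M : OrientedMatroid E) (n : ℕ) :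
    ∀ X ∈ M.circuits, ∀ Y ∈ M.circuits, {h | X h ≠ 0 ∨ Y h ≠ 0}.ncard = n →
      ∀ e f, X e ≠ 0 → Y e = -X e → X f ≠ 0 → Y f ≠ -X f → M.EliminatesKeeping X Y e f := by
  induction n using Nat.strong_induction_on with
  | _ n IH =>
    have small : ∀ X Y : E → SignType, {h | X h ≠ 0 ∨ Y h ≠ 0}.ncard = n →
        ∀ V ∈ M.circuits, ∀ W ∈ M.circuits,
        (∀ h, V h ≠ 0 ∨ W h ≠ 0 → X h ≠ 0 ∨ Y h ≠ 0) →
        (∃ a, (X a ≠ 0 ∨ Y a ≠ 0) ∧ V a = 0 ∧ W a = 0) → ∀ a b, V a ≠ 0 → W a = -V a →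
        V b ≠ 0 → W b ≠ -V b → M.EliminatesKeeping V W a b := by
      intro X Y hn V hV W hW hsub ⟨c, hc, hcV, hcW⟩
      refine IH _ ?_ V hV W hW rfl
      rw [← hn]
      refine Set.ncard_lt_ncard ⟨hsub, fun h => ?_⟩ (Set.toFinite _)
      have := h hc
      simp [hcV, hcW] at this
    have hneg : ∀ a : SignType, a ≠ 0 → (0 : SignType) ≠ -a := by decide
    have single : ∀ X ∈ M.circuits, ∀ Y ∈ M.circuits, {h | X h ≠ 0 ∨ Y h ≠ 0}.ncard = n →
        ∀ e f, X e ≠ 0 → Y e = -X e → X f ≠ 0 → Y f = 0 → M.EliminatesKeeping X Y e f := by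
      intro X hX Y hY hn e f he heY hf hfY
      refine M.eliminatesKeeping_step hX hY he heY hf (hfY ▸ hneg _ hf) (small X Y hn) ?_
      intro V hV W hW hsub h0 a b ha haW hb hbW
      exact small X Y hn V hV W hW hsub ⟨f, Or.inl hf, h0 hfY⟩ a b ha haW hb (hbW ▸ hneg _ hb)
    intro X hX Y hY hn e f he heY hf hfY
    refine M.eliminatesKeeping_step hX hY he heY hf hfY (small X Y hn) ?_
    intro V hV W hW hsub _ a b ha haW hb hbW
    by_cases hss : ∃ a, (X a ≠ 0 ∨ Y a ≠ 0) ∧ V a = 0 ∧ W a = 0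
    · exact small X Y hn V hV W hW hsub hss a b ha haW hb (hbW ▸ hneg _ hb)
    · refine single V hV W hW ?_ a b ha haW hb hbW
      rw [← hn]
      congr 1
      ext h
      refine ⟨hsub h, fun hh => ?_⟩
      by_contra hcon
      simp only [Set.mem_ofPred_eq, not_or, not_not] at hcon
      exact hss ⟨h, hh, hcon⟩

/-- Strong elimination for signed circuits. -/
theorem strong_elimination (M : OrientedMatroid E) {X Y : E → SignType} (hX : X ∈ M.circuits)
    (hY : Y ∈ M.circuits) {e f : E} (he : X e = 1) (heY : Y e = -1)
    (hfX : 0 ≤ X f) (hfY : 0 ≤ Y f) (hf : X f = 1 ∨ Y f = 1) :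
    ∃ Z ∈ M.circuits, Z e = 0 ∧ Z f = 1 ∧ ∀ h, Z h = 0 ∨ Z h = X h ∨ Z h = Y h := by
  have key : M.EliminatesKeeping X Y e f := by
    rcases hf with hf | hf
    · refine M.eliminatesKeeping_of_ne_zero _ X hX Y hY rfl e f (by simp [he]) (by rw [he, heY])
        (by simp [hf]) ?_
      rw [hf]; revert hfY; generalize Y f = y; revert y; decide
    · refine (M.eliminatesKeeping_of_ne_zero _ Y hY X hX rfl e f (by simp [heY])
        (by rw [he, heY]; rfl) (by simp [hf]) ?_).symm
      rw [hf]; revert hfX; generalize X f = y; revert y; decide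
  obtain ⟨Z, hZ, h1, h2, h3⟩ := key
  refine ⟨Z, hZ, h1, ?_, h3⟩
  have h4 := h3 f
  revert hfX hfY hf h2 h4
  generalize X f = x; generalize Y f = y; generalize Z f = z
  revert x y z; decide

end OrientedMatroid

/-! ### Circuits of the underlying matroid and Farkas' lemma -/

namespace OrientedMatroid

variable {E : Type*} [DecidableEq E] [Fintype E]

theorem toMatroid_indep_iff_set (M : OrientedMatroid E) (I : Set E) :
    M.toMatroid.Indep I ↔ ∀ X ∈ M.circuits, ¬ Function.support X ⊆ I := by
  classical
  have := M.toMatroid_indep_iff I.toFinset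
  simpa using this

theorem toMatroid_isCircuit_iff (M : OrientedMatroid E) (C : Set E) :
    M.toMatroid.IsCircuit C ↔ ∃ X ∈ M.circuits, Function.support X = C := by
  rw [Matroid.isCircuit_iff_minimal_not_indep (Set.subset_univ _)]
  simp only [toMatroid_indep_iff_set, not_forall, not_not]
  constructor
  · rintro ⟨⟨X, hX, hXC⟩, hmin⟩
    exact ⟨X, hX, hXC.antisymm (hmin ⟨X, hX, subset_rfl⟩ hXC)⟩
  · rintro ⟨X, hX, rfl⟩
    refine ⟨⟨X, hX, subset_rfl⟩, ?_⟩
    rintro D ⟨Y, hY, hYD⟩ hDX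
    have hsupp : Function.support Y = Function.support X := by
      rcases M.incomparable Y hY X hX (hYD.trans hDX) with rfl | rfl
      · rfl
      · ext f; cases h : X f <;> simp [h]
    exact hsupp ▸ hYD

theorem toMatroid_mem_closure_iff (M : OrientedMatroid E) {e : E} {S : Set E} (he : e ∉ S) :
    e ∈ M.toMatroid.closure S ↔ ∃ X ∈ M.circuits, X e ≠ 0 ∧ ∀ h, X h ≠ 0 → h = e ∨ h ∈ S := by
  rw [Matroid.mem_closure_iff_exists_isCircuit he]
  simp only [toMatroid_isCircuit_iff]
  constructor
  · rintro ⟨C, heC, ⟨X, hX, rfl⟩, hC⟩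
    exact ⟨X, hX, hC, fun h hh => heC hh⟩
  · rintro ⟨X, hX, hXe, hXs⟩
    exact ⟨_, hXs, ⟨X, hX, rfl⟩, hXe⟩

/-- Suppose that every circuit positive at `e` is negative somewhere on `D`, and that for each
`f ∈ D` other than `e` some such circuit is negative only at `f` on `D`. Then that circuit can be
chosen to vanish on a given `G ⊆ D` avoiding `e` and `f`. -/
theorem exists_circuit_of_eliminate (M : OrientedMatroid E) {D : Finset E} {e : E}
    (hD : ∀ X ∈ M.circuits, X e = 1 → ∃ h ∈ D, X h = -1)
    (hD' : ∀ f ∈ D, f ≠ e → ∃ X ∈ M.circuits, X e = 1 ∧ ∀ h ∈ D, h ≠ f → 0 ≤ X h)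
    (G : Finset E) : G ⊆ D → e ∉ G → ∀ f ∈ D, f ∉ G → f ≠ e →
      ∃ X ∈ M.circuits, X e = 1 ∧ X f = -1 ∧ (∀ h ∈ D, h ≠ f → 0 ≤ X h) ∧ ∀ h ∈ G, X h = 0 := by
  have hs : ∀ s : SignType, 0 ≤ s → s ≠ -1 := by decide
  have main : ∀ f, ∀ X ∈ M.circuits, X e = 1 → (∀ h ∈ D, h ≠ f → 0 ≤ X h) → X f = -1 := by
    intro f X hX hXe hX0
    obtain ⟨h, hh, hXh⟩ := hD X hX hXe
    by_cases hhf : h = f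
    · rwa [← hhf]
    · exact absurd hXh (hs _ (hX0 h hh hhf))
  induction G using Finset.induction_on with
  | empty =>
    intro _ _ f hf _ hfe
    obtain ⟨X, hX, hXe, hX0⟩ := hD' f hf hfe
    exact ⟨X, hX, hXe, main f X hX hXe hX0, hX0, by simp⟩
  | insert g G hg ih =>
    intro hGD heG f hf hfG hfe
    rw [Finset.mem_insert, not_or] at heG hfG
    have hGD' := (Finset.subset_insert _ _).trans hGD
    have hgD := hGD (Finset.mem_insert_self _ _)
    obtain ⟨X, hX, hXe, hXf, hX0, hXG⟩ := ih hGD' heG.2 f hf hfG.2 hfe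
    obtain ⟨Y, hY, hYe, hYg, hY0, hYG⟩ := ih hGD' heG.2 g hgD hg (Ne.symm heG.1)
    by_cases hXg : X g = 0
    · refine ⟨X, hX, hXe, hXf, hX0, fun h hh => ?_⟩
      rcases Finset.mem_insert.1 hh with rfl | hh
      · exact hXg
      · exact hXG h hh
    have hXg1 : X g = 1 := by
      have := hX0 g hgD (Ne.symm hfG.1)
      revert hXg this
      generalize X g = a; revert a; decide
    -- The only element of `D` other than `f` where `X` or `Y` can be negative is `g`, where `Z`
    -- vanishes. So `Z` is nonnegative on `D` off `f`, and `main` forces `Z f = -1`.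
    obtain ⟨Z, hZ, hZg, hZe, hZs⟩ := M.strong_elimination hX hY (f := e) hXg1 hYg
      (by rw [hXe]; decide) (by rw [hYe]; decide) (Or.inl hXe)
    have hZ0 : ∀ h ∈ D, h ≠ f → 0 ≤ Z h := by
      intro h hh hhf
      by_cases hhg : h = g
      · rw [hhg, hZg]
      rcases hZs h with h1 | h1 | h1 <;> rw [h1]
      · exact hX0 h hh hhf
      · exact hY0 h hh hhg
    refine ⟨Z, hZ, hZe, main f Z hZ hZe hZ0, hZ0, fun h hh => ?_⟩
    rcases Finset.mem_insert.1 hh with rfl | hh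
    · exact hZg
    · have := hZs h
      rw [hXG h hh, hYG h hh] at this
      simpa using this

/-- Farkas' lemma for oriented matroids. -/
theorem exists_isPositiveCocircuit (M : OrientedMatroid E) (S : Finset E) {e : E} (he : e ∉ S)
    (hS : ¬ ∃ X ∈ M.circuits, X e = 1 ∧ ∀ h, h ∉ S → 0 ≤ X h) :
    ∃ D, M.IsPositiveCocircuit D ∧ e ∈ D ∧ Disjoint D S := by
  -- Enlarge `S` to a maximal set `T` of unconstrained elements for which the system stays
  -- infeasible. The complement of `T` will be the cocircuit.
  obtain ⟨T, hST, ⟨heT, hT⟩, hmax⟩ := (Set.toFinite {T : Finset E | e ∉ T ∧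
    ¬ ∃ X ∈ M.circuits, X e = 1 ∧ ∀ h, h ∉ T → 0 ≤ X h}).exists_le_maximal ⟨he, hS⟩
  have hD : ∀ X ∈ M.circuits, X e = 1 → ∃ h ∈ Tᶜ, X h = -1 := by
    intro X hX hXe
    by_contra! hcon
    refine hT ⟨X, hX, hXe, fun h hh => ?_⟩
    have := hcon h (by simpa using hh)
    revert this; generalize X h = a; revert a; decide
  have hD' : ∀ f ∈ Tᶜ, f ≠ e → ∃ X ∈ M.circuits, X e = 1 ∧ ∀ h ∈ Tᶜ, h ≠ f → 0 ≤ X h := by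
    intro f hf hfe
    by_contra hcon
    have : insert f T ≤ T := by
      refine hmax ⟨by simp [heT, Ne.symm hfe], ?_⟩ (Finset.subset_insert _ _)
      rintro ⟨X, hX, hXe, hX0⟩
      exact hcon ⟨X, hX, hXe, fun h hh hhf => hX0 h (by
        simpa [hhf] using hh)⟩
    exact (Finset.mem_compl.1 hf) (this (Finset.mem_insert_self _ _))
  have hcirc := M.exists_circuit_of_eliminate hD hD'
  have hpair : ∀ f ∈ Tᶜ, f ≠ e → ∃ X ∈ M.circuits, X e = 1 ∧ X f = -1 ∧
      ∀ h, X h ≠ 0 → h = e ∨ h = f ∨ h ∈ T := by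
    intro f hf hfe
    obtain ⟨X, hX, hXe, hXf, -, hX0⟩ := hcirc ((Tᶜ.erase e).erase f)
      ((Finset.erase_subset _ _).trans (Finset.erase_subset _ _)) (by simp) f hf (by simp) hfe
    refine ⟨X, hX, hXe, hXf, fun h hh => ?_⟩
    by_contra! hcon
    exact hh (hX0 h (by simp [hcon]))
  -- This yields orthogonality to the positive vector of `Tᶜ`. If such an `X` were positive at some
  -- `f ≠ e`, eliminating `f` against the circuit of `hpair` would give a circuit positive at `e`
  -- and nonnegative on `Tᶜ`, contradicting `hD`.
  have hnonneg : ∀ X ∈ M.circuits, (∀ h ∈ Tᶜ, 0 ≤ X h) → ∀ h ∈ Tᶜ, X h = 0 := by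
    intro X hX hX0 f hf
    by_contra hXf
    have hXf1 : X f = 1 := by
      have := hX0 f hf
      revert hXf this; generalize X f = a; revert a; decide
    by_cases hfe : f = e
    · obtain ⟨h, hh, hXh⟩ := hD X hX (hfe ▸ hXf1)
      have := hX0 h hh
      rw [hXh] at this
      exact absurd this (by decide)
    obtain ⟨Y, hY, hYe, hYf, hYs⟩ := hpair f hf hfe
    obtain ⟨Z, hZ, hZf, hZe, hZs⟩ := M.strong_elimination hX hY (f := e) hXf1 hYf
      (hX0 e (by simpa using heT)) (by rw [hYe]; decide) (Or.inr hYe)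
    obtain ⟨h, hh, hZh⟩ := hD Z hZ hZe
    have hhf : h ≠ f := by rintro rfl; rw [hZf] at hZh; exact absurd hZh (by decide)
    have hhe : h ≠ e := by rintro rfl; rw [hZe] at hZh; exact absurd hZh (by decide)
    rcases hZs h with h1 | h1 | h1
    · rw [h1] at hZh; exact absurd hZh (by decide)
    · have := hX0 h hh
      rw [← h1, hZh] at this
      exact absurd this (by decide)
    · have hYh : Y h ≠ 0 := by rw [← h1, hZh]; decide
      rcases hYs h hYh with h2 | h2 | h2
      · exact hhe h2
      · exact hhf h2
      · exact (Finset.mem_compl.1 hh) h2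
  have hsupp : Function.support (positiveVector Tᶜ) = ((Tᶜ : Finset E) : Set E) := by
    ext h; by_cases hh : h ∈ T <;> simp [positiveVector, hh]
  refine ⟨Tᶜ, ⟨?_, ?_⟩, by simpa using heT, ?_⟩
  -- `T` does not span `e`, by `hnonneg`; but `T` with any `f ∈ Tᶜ` spans first `e` and then
  -- everything, through the circuits of `hpair`.
  · rw [hsupp, Matroid.isCocircuit_iff_minimal_compl_nonspanning]
    refine ⟨?_, ?_⟩
    · intro hsp
      have : e ∈ M.toMatroid.closure (M.toMatroid.E \ ((Tᶜ : Finset E) : Set E)) := by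
        rw [hsp.closure_eq]; trivial
      rw [toMatroid_mem_closure_iff _ (by simp [heT])] at this
      obtain ⟨X, hX, hXe, hXs⟩ := this
      have hX0 : ∀ h ∈ Tᶜ, h ≠ e → X h = 0 := by
        intro h hh hhe
        by_contra hXh
        rcases hXs h hXh with h1 | h1
        · exact hhe h1
        · exact h1.2 hh
      have heT' : e ∈ Tᶜ := by simpa using heT
      have h1 : X e = 1 ∨ X e = -1 := by
        revert hXe; generalize X e = a; revert a; decide
      rcases h1 with h1 | h1
      · refine hXe (hnonneg X hX (fun h hh => ?_) e heT')
        by_cases hhe : h = e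
        · rw [hhe, h1]; decide
        · rw [hX0 h hh hhe]
      · have h2 := hnonneg (-X) (M.neg_mem X hX) (fun h hh => by
          by_cases hhe : h = e
          · rw [hhe, Pi.neg_apply, h1]; decide
          · rw [Pi.neg_apply, hX0 h hh hhe]; decide) e heT'
        rw [Pi.neg_apply, h1] at h2
        exact absurd h2 (by decide)
    · intro D' hD' hsub
      by_contra hne
      obtain ⟨f, hfT, hfD⟩ := Set.not_subset.1 hne
      apply hD'
      have hle : insert f (T : Set E) ⊆ M.toMatroid.E \ D' := by
        intro h hh
        refine ⟨trivial, fun hD'h => ?_⟩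
        rcases hh with rfl | hh
        · exact hfD hD'h
        · exact (Finset.mem_compl.1 (hsub hD'h)) hh
      refine Matroid.Spanning.superset ?_ hle Set.sdiff_subset
      rw [Matroid.spanning_iff_ground_subset_closure (Set.subset_univ _)]
      have hmem : ∀ h ∈ insert f (T : Set E), h ∈ M.toMatroid.closure (insert f (T : Set E)) :=
        fun h hh => M.toMatroid.mem_closure_of_mem hh (Set.subset_univ _)
      have hecl : e ∈ M.toMatroid.closure (insert f (T : Set E)) := by
        by_cases hfe : f = e
        · exact hmem e (by simp [hfe])
        obtain ⟨X, hX, hXe, hXf, hXs⟩ := hpair f hfT hfe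
        rw [toMatroid_mem_closure_iff _ (by simp [Ne.symm hfe, heT])]
        exact ⟨X, hX, by simp [hXe], hXs⟩
      intro g _
      by_cases hgT : g ∈ insert f (T : Set E)
      · exact hmem g hgT
      by_cases hge : g = e
      · rwa [hge]
      rw [← Matroid.closure_insert_eq_of_mem_closure hecl, toMatroid_mem_closure_iff]
      · have hgT' : g ∈ Tᶜ := by
          rw [Finset.mem_compl]; exact fun h => hgT (Set.mem_insert_of_mem _ h)
        obtain ⟨X, hX, hXe, hXg, hXs⟩ := hpair g hgT' hge
        refine ⟨X, hX, by simp [hXg], fun h hh => ?_⟩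
        rcases hXs h hh with h1 | h1 | h1 <;> simp [h1]
      · rw [Set.mem_insert_iff, not_or]; exact ⟨hge, hgT⟩
  · intro X hX
    have hmul : ∀ h, X h * positiveVector Tᶜ h = if h ∈ Tᶜ then X h else 0 := by
      intro h; unfold positiveVector; split <;> simp
    by_cases h0 : ∀ h ∈ Tᶜ, X h = 0
    · left
      intro h
      rw [hmul]; split
      · exact h0 h ‹_›
      · rfl
    right
    constructor
    · by_contra! hcon
      refine h0 fun h hh => ?_
      simpa using hnonneg (-X) (M.neg_mem X hX) (fun h hh => by
        have := hcon h
        rw [hmul, if_pos hh] at this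
        rw [Pi.neg_apply]
        revert this; generalize X h = a; revert a; decide) h hh
    · by_contra! hcon
      refine h0 (hnonneg X hX fun h hh => ?_)
      have := hcon h
      rw [hmul, if_pos hh] at this
      revert this; generalize X h = a; revert a; decide
  · exact Disjoint.mono_right hST disjoint_compl_left

end OrientedMatroid

namespace OrientedMatroid

variable {E : Type*}

theorem mem_reorient_circuits [DecidableEq E] (M : OrientedMatroid E) (A : Finset E)
    (X : E → SignType) : X ∈ (M.reorient A).circuits ↔ signReverse A X ∈ M.circuits := Iff.rfl

theorem signReverse_insert [DecidableEq E] {A : Finset E} {n : E} (hn : n ∉ A)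
    (X : E → SignType) : signReverse (insert n A) X = signReverse A (signReverse {n} X) := by
  funext e
  by_cases he : e = n
  · subst he; simp [signReverse, hn]
  · simp [signReverse, he]

theorem signReverse_ne_zero [DecidableEq E] (A : Finset E) (X : E → SignType) (e : E) :
    signReverse A X e ≠ 0 ↔ X e ≠ 0 := by
  rw [← Function.mem_support, support_signReverse, Function.mem_support]

/-! ### Deletion and contraction for the corank-nullity sum -/

section Rank

variable (M : Matroid E)

theorem matroidRank_insert_of_mem_closure {A : Set E} {n : E} (h : n ∈ M.closure A) :
    matroidRank M (insert n A) = matroidRank M A := by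
  unfold matroidRank
  rw [← Matroid.eRk_closure_eq, Matroid.closure_insert_eq_of_mem_closure h, Matroid.eRk_closure_eq]

/-- The corank-nullity sum of the minor obtained by contracting `K` and restricting to `S`. -/
noncomputable def minorTutte (p q : ℤ) (S K : Finset E) : ℤ :=
  ∑ B ∈ S.powerset, p ^ (matroidRank M (S ∪ K) - matroidRank M (B ∪ K)) *
    q ^ (B.card + matroidRank M K - matroidRank M (B ∪ K))

theorem minorTutte_empty (p q : ℤ) (K : Finset E) : minorTutte M p q ∅ K = 1 := by
  simp [minorTutte]

variable [Finite E]

theorem matroidRank_mono {A B : Set E} (h : A ⊆ B) : matroidRank M A ≤ matroidRank M B :=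
  ENat.toNat_le_toNat (M.eRk_mono h)
    (Matroid.eRk_ne_top_iff.2 (M.isRkFinite_of_finite (Set.toFinite B)))

theorem matroidRank_insert_of_notMem_closure {A : Set E} {n : E} (hn : n ∈ M.E)
    (h : n ∉ M.closure A) : matroidRank M (insert n A) = matroidRank M A + 1 := by
  unfold matroidRank
  rw [Matroid.eRk_insert_eq_add_one ⟨hn, h⟩,
    ENat.toNat_add (Matroid.eRk_ne_top_iff.2 (M.isRkFinite_of_finite (Set.toFinite A))) (by simp)]
  rfl

/-- Ensures that the natural number subtraction in the nullity exponent of `minorTutte` does not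
truncate. -/
theorem matroidRank_union_le (B : Finset E) (K : Set E) :
    matroidRank M (B ∪ K) ≤ B.card + matroidRank M K := by
  have hK : M.eRk K ≠ ⊤ := Matroid.eRk_ne_top_iff.2 (M.isRkFinite_of_finite (Set.toFinite K))
  have h : M.eRk (B ∪ K) ≤ B.card + M.eRk K := by
    refine (M.eRk_union_le_eRk_add_eRk _ _).trans ?_
    gcongr
    simpa using M.eRk_le_encard (B : Set E)
  have := ENat.toNat_le_toNat h (by simp [hK])
  rwa [ENat.toNat_add (by simp) hK, ENat.toNat_natCast] at this

variable {M} [DecidableEq E]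

theorem minorTutte_insert_of_loop (p q : ℤ) {S K : Finset E} {n : E} (hnS : n ∉ S)
    (h : n ∈ M.closure K) :
    minorTutte M p q (insert n S) K = (q + 1) * minorTutte M p q S K := by
  have hr : ∀ B : Finset E, matroidRank M (((insert n B : Finset E) : Set E) ∪ K) =
      matroidRank M (B ∪ K) := fun B => by
    rw [Finset.coe_insert, Set.insert_union, matroidRank_insert_of_mem_closure]
    exact M.closure_subset_closure Set.subset_union_right h
  rw [minorTutte, Finset.sum_powerset_insert hnS, add_comm, minorTutte, add_mul, one_mul,
    Finset.mul_sum]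
  congr 1
  · refine Finset.sum_congr rfl fun B hB => ?_
    have hnB : n ∉ B := fun h => hnS (Finset.mem_powerset.1 hB h)
    rw [hr, hr, Finset.card_insert_of_notMem hnB]
    have := matroidRank_union_le M B K
    rw [show B.card + 1 + matroidRank M K - matroidRank M (B ∪ K) =
      (B.card + matroidRank M K - matroidRank M (B ∪ K)) + 1 by omega, pow_succ]
    ring
  · rw [hr]

theorem minorTutte_insert_of_coloop (p q : ℤ) {S K : Finset E} {n : E} (hnS : n ∉ S)
    (hn : n ∈ M.E) (h : n ∉ M.closure (S ∪ K)) :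
    minorTutte M p q (insert n S) K = (p + 1) * minorTutte M p q S K := by
  have hr : ∀ B ⊆ S, matroidRank M (((insert n B : Finset E) : Set E) ∪ K) =
      matroidRank M (B ∪ K) + 1 := fun B hB => by
    rw [Finset.coe_insert, Set.insert_union, matroidRank_insert_of_notMem_closure _ hn]
    exact fun h' => h (M.closure_subset_closure
      (Set.union_subset_union_left _ (by exact_mod_cast hB)) h')
  rw [minorTutte, Finset.sum_powerset_insert hnS, minorTutte, add_mul, one_mul,
    Finset.mul_sum]
  congr 1
  · refine Finset.sum_congr rfl fun B hB => ?_
    have hBS := Finset.mem_powerset.1 hB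
    have := matroidRank_mono M (Set.union_subset_union_left (K : Set E)
      (show (B : Set E) ⊆ S by exact_mod_cast hBS))
    rw [hr S subset_rfl, show matroidRank M (S ∪ K) + 1 - matroidRank M (B ∪ K) =
      (matroidRank M (S ∪ K) - matroidRank M (B ∪ K)) + 1 by omega, pow_succ]
    ring
  · refine Finset.sum_congr rfl fun B hB => ?_
    have hBS := Finset.mem_powerset.1 hB
    rw [hr S subset_rfl, hr B hBS, Finset.card_insert_of_notMem (fun h => hnS (hBS h)),
      Nat.add_sub_add_right, Nat.add_right_comm, Nat.add_sub_add_right]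

/-- Subsets avoiding `n` give the deletion, because the rank of the whole is unchanged. Subsets
containing `n` give the contraction: moving `n` from `B` to `K` trades one unit of cardinality for
one unit of the rank of `K`. -/
theorem minorTutte_insert (p q : ℤ) {S K : Finset E} {n : E} (hnS : n ∉ S)
    (hn : n ∈ M.E) (h : n ∈ M.closure (S ∪ K)) (hK : n ∉ M.closure K) :
    minorTutte M p q (insert n S) K =
      minorTutte M p q S K + minorTutte M p q S (insert n K) := by
  have hS : matroidRank M (((insert n S : Finset E) : Set E) ∪ K) = matroidRank M (S ∪ K) := by
    rw [Finset.coe_insert, Set.insert_union, matroidRank_insert_of_mem_closure _ h]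
  have hr : ∀ B : Finset E, (B : Set E) ∪ ((insert n K : Finset E) : Set E) =
      ((insert n B : Finset E) : Set E) ∪ K := fun B => by
    rw [Finset.coe_insert, Finset.coe_insert, Set.insert_union, Set.union_insert]
  rw [minorTutte, Finset.sum_powerset_insert hnS, hS, minorTutte, minorTutte]
  congr 1
  refine Finset.sum_congr rfl fun B hB => ?_
  have hBS := Finset.mem_powerset.1 hB
  rw [hr, hr, hS, Finset.coe_insert n K, matroidRank_insert_of_notMem_closure _ hn hK,
    Finset.card_insert_of_notMem (fun h => hnS (hBS h))]
  congr 2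
  omega

end Rank

/-! ### Activities and their behaviour at the largest element -/

section Activity

variable [LinearOrder E]

/-- In the minor of `-_A M` obtained by contracting `K` and restricting to `S`, some positive
circuit has minimum `e` (for `b = true`), resp. no positive cocircuit has minimum `e`
(for `b = false`), expressed in terms of the signed circuits of `M`. -/
def Active (M : OrientedMatroid E) (S K A : Finset E) (b : Bool) (e : E) : Prop :=
  ∃ X ∈ (M.reorient A).circuits, X e = 1 ∧ (∀ h ∈ S, e < h → 0 ≤ X h) ∧
    (b = true → ∀ h ∈ S, h < e → X h = 0) ∧ ∀ h, X h ≠ 0 → h ∈ S ∨ h ∈ K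

/-- A variant of `Active` on the ground set `insert n S`, with a constraint on the sign of `n`. -/
def ActiveWith (N : OrientedMatroid E) (S K : Finset E) (n : E) (p : SignType → Prop) (b : Bool)
    (e : E) : Prop :=
  ∃ X ∈ N.circuits, X e = 1 ∧ (∀ h ∈ S, e < h → 0 ≤ X h) ∧
    (b = true → ∀ h ∈ S, h < e → X h = 0) ∧ p (X n) ∧ ∀ h, X h ≠ 0 → h = n ∨ h ∈ S ∨ h ∈ K

theorem ActiveWith.mono {N : OrientedMatroid E} {S K : Finset E} {n : E} {p p' : SignType → Prop}
    {b : Bool} {e : E} (h : ActiveWith N S K n p b e) (hp : ∀ s, p s → p' s) :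
    ActiveWith N S K n p' b e := by
  obtain ⟨X, h1, h2, h3, h4, h5, h6⟩ := h
  exact ⟨X, h1, h2, h3, h4, hp _ h5, h6⟩

variable (M : OrientedMatroid E) {S K A : Finset E} {n e : E} (b : Bool)

/-- As `n` exceeds every `e ∈ S`, both kinds of activity at `e` constrain `n` only by a sign
condition. -/
theorem active_insert_iff (hn : ∀ s ∈ S, s < n) (he : e ∈ S) :
    M.Active (insert n S) K A b e ↔ ActiveWith (M.reorient A) S K n (0 ≤ ·) b e := by
  refine exists_congr fun X => and_congr_right fun _ => and_congr_right fun _ => ?_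
  simp only [Finset.forall_mem_insert, hn e he, forall_const, (hn e he).not_gt, false_imp_iff,
    true_and]
  simp only [Finset.mem_insert, or_assoc]
  tauto

/-- Flipping the sign at `n` matches the circuits of the two reorientations. Both orientations of
`n` can thus be compared inside the single oriented matroid `-_A M`. -/
theorem active_insert_insert_iff (hn : ∀ s ∈ S, s < n) (hnA : n ∉ A) (he : e ∈ S) :
    M.Active (insert n S) K (insert n A) b e ↔
      ActiveWith (M.reorient A) S K n (· ≤ 0) b e := by
  have hne : ∀ s ∈ S, s ≠ n := fun s hs => (hn s hs).ne
  have hrev : ∀ X : E → SignType, ∀ s ∈ S, signReverse {n} X s = X s := fun X s hs => by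
    simp [signReverse, hne s hs]
  have hrevn : ∀ X : E → SignType, signReverse {n} X n = -X n := fun X => by simp [signReverse]
  have hs : ∀ s : SignType, 0 ≤ s ↔ -s ≤ 0 := by decide
  have key : ∀ X, (X ∈ (M.reorient (insert n A)).circuits ∧ X e = 1 ∧
      (∀ h ∈ insert n S, e < h → 0 ≤ X h) ∧ (b = true → ∀ h ∈ insert n S, h < e → X h = 0) ∧
      ∀ h, X h ≠ 0 → h ∈ insert n S ∨ h ∈ K) ↔
      (signReverse {n} X ∈ (M.reorient A).circuits ∧ signReverse {n} X e = 1 ∧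
      (∀ h ∈ S, e < h → 0 ≤ signReverse {n} X h) ∧
      (b = true → ∀ h ∈ S, h < e → signReverse {n} X h = 0) ∧ signReverse {n} X n ≤ 0 ∧
      ∀ h, signReverse {n} X h ≠ 0 → h = n ∨ h ∈ S ∨ h ∈ K) := by
    intro X
    rw [mem_reorient_circuits, signReverse_insert hnA, ← mem_reorient_circuits, hrev X e he, hrevn]
    simp only [signReverse_ne_zero]
    simp +contextual only [Finset.forall_mem_insert, hn e he, forall_const, (hn e he).not_gt,
      false_imp_iff, true_and, hrev, hs (X n)]
    simp only [Finset.mem_insert, or_assoc]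
    tauto
  constructor
  · rintro ⟨X, hX⟩
    exact ⟨_, (key X).1 hX⟩
  · rintro ⟨X, hX⟩
    refine ⟨signReverse {n} X, (key _).2 ?_⟩
    rwa [signReverse_signReverse]

/-- Deletion of `n` as a condition on the sign at `n`. -/
theorem active_iff_activeWith_eq (hnS : n ∉ S) (hnK : n ∉ K) :
    M.Active S K A b e ↔ ActiveWith (M.reorient A) S K n (· = 0) b e := by
  refine exists_congr fun X => and_congr_right fun _ => and_congr_right fun _ =>
    and_congr_right fun _ => and_congr_right fun _ => ⟨fun h => ⟨?_, fun a ha => Or.inr (h a ha)⟩,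
      fun ⟨h0, h⟩ a ha => (h a ha).resolve_left ?_⟩
  · by_contra hn
    exact (h n hn).elim hnS hnK
  · rintro rfl
    exact ha h0

/-- Contraction of `n` leaves the sign at `n` free. -/
theorem active_insert_right_iff :
    M.Active S (insert n K) A b e ↔ ActiveWith (M.reorient A) S K n (fun _ => True) b e := by
  refine exists_congr fun X => and_congr_right fun _ => and_congr_right fun _ =>
    and_congr_right fun _ => and_congr_right fun _ => ?_
  simp only [Finset.mem_insert, true_and]
  exact forall_congr' fun a => imp_congr_right fun _ => by tauto

variable {b}

/-- If neither witness vanishes at `n`, they have opposite signs there, and strong elimination of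
`n` produces a witness for whichever of `e`, `f` is kept. The choice depends on the kinds: the
smaller element for two circuit activities, the larger one for two activities with `b = false`, and
the one with `b = false` in the mixed case, where the other witness is nonnegative on all of `S`. -/
theorem activeWith_eq_zero_of_nonneg_of_nonpos [Finite E] (N : OrientedMatroid E) {c : Bool} {f : E}
    (he : e ∈ S) (hf : f ∈ S) (h₁ : ActiveWith N S K n (0 ≤ ·) b e)
    (h₂ : ActiveWith N S K n (· ≤ 0) c f) :
    ActiveWith N S K n (· = 0) b e ∨ ActiveWith N S K n (· = 0) c f := by
  obtain ⟨X, hX, hXe, hXp, hXz, hXn, hXs⟩ := h₁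
  obtain ⟨Y, hY, hYf, hYp, hYz, hYn, hYs⟩ := h₂
  by_cases hXn0 : X n = 0
  · exact Or.inl ⟨X, hX, hXe, hXp, hXz, hXn0, hXs⟩
  by_cases hYn0 : Y n = 0
  · exact Or.inr ⟨Y, hY, hYf, hYp, hYz, hYn0, hYs⟩
  have hXn1 : X n = 1 := by
    revert hXn hXn0; generalize X n = a; revert a; decide
  have hYn1 : Y n = -1 := by
    revert hYn hYn0; generalize Y n = a; revert a; decide
  have hone : (0 : SignType) ≤ 1 := by decide
  have hX0 : b = true → ∀ h ∈ S, 0 ≤ X h := by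
    intro hb h hh
    rcases lt_trichotomy h e with h1 | rfl | h1
    · rw [hXz hb h hh h1]
    · rw [hXe]; exact hone
    · exact hXp h hh h1
  have hY0 : c = true → ∀ h ∈ S, 0 ≤ Y h := by
    intro hb h hh
    rcases lt_trichotomy h f with h1 | rfl | h1
    · rw [hYz hb h hh h1]
    · rw [hYf]; exact hone
    · exact hYp h hh h1
  have keepe : 0 ≤ Y e → (∀ h ∈ S, e < h → 0 ≤ Y h) →
      (b = true → ∀ h ∈ S, h < e → Y h = 0) → ActiveWith N S K n (· = 0) b e := by
    intro hYe hYp' hYz'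
    obtain ⟨Z, hZ, hZn, hZe, hZs⟩ := N.strong_elimination hX hY (f := e) hXn1 hYn1
      (by rw [hXe]; exact hone) hYe (Or.inl hXe)
    refine ⟨Z, hZ, hZe, fun h hh hlt => ?_, fun hb h hh hlt => ?_, hZn, fun h hh => ?_⟩
    · rcases hZs h with h1 | h1 | h1 <;> rw [h1]
      exacts [hXp h hh hlt, hYp' h hh hlt]
    · have := hZs h
      rw [hXz hb h hh hlt, hYz' hb h hh hlt] at this
      simpa using this
    · rcases hZs h with h1 | h1 | h1 <;> rw [h1] at hh
      exacts [absurd rfl hh, hXs h hh, hYs h hh]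
  have keepf : 0 ≤ X f → (∀ h ∈ S, f < h → 0 ≤ X h) →
      (c = true → ∀ h ∈ S, h < f → X h = 0) → ActiveWith N S K n (· = 0) c f := by
    intro hXf hXp' hXz'
    obtain ⟨Z, hZ, hZn, hZf, hZs⟩ := N.strong_elimination hX hY (f := f) hXn1 hYn1
      hXf (by rw [hYf]; exact hone) (Or.inr hYf)
    refine ⟨Z, hZ, hZf, fun h hh hlt => ?_, fun hb h hh hlt => ?_, hZn, fun h hh => ?_⟩
    · rcases hZs h with h1 | h1 | h1 <;> rw [h1]
      exacts [hXp' h hh hlt, hYp h hh hlt]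
    · have := hZs h
      rw [hXz' hb h hh hlt, hYz hb h hh hlt] at this
      simpa using this
    · rcases hZs h with h1 | h1 | h1 <;> rw [h1] at hh
      exacts [absurd rfl hh, hXs h hh, hYs h hh]
  cases b with
  | true =>
    cases c with
    | true =>
      rcases le_total e f with hef | hef
      · exact Or.inl (keepe (hY0 rfl e he) (fun h hh _ => hY0 rfl h hh)
          fun _ h hh hlt => hYz rfl h hh (hlt.trans_le hef))
      · exact Or.inr (keepf (hX0 rfl f hf) (fun h hh _ => hX0 rfl h hh)
          fun _ h hh hlt => hXz rfl h hh (hlt.trans_le hef))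
    | false =>
      exact Or.inr (keepf (hX0 rfl f hf) (fun h hh _ => hX0 rfl h hh) (by simp))
  | false =>
    cases c with
    | true =>
      exact Or.inl (keepe (hY0 rfl e he) (fun h hh _ => hY0 rfl h hh) (by simp))
    | false =>
      rcases le_total e f with hef | hef
      · refine Or.inr (keepf ?_ (fun h hh hlt => hXp h hh (hef.trans_lt hlt)) (by simp))
        rcases hef.eq_or_lt with rfl | hlt
        · rw [hXe]; exact hone
        · exact hXp f hf hlt
      · refine Or.inl (keepe ?_ (fun h hh hlt => hYp h hh (hef.trans_lt hlt)) (by simp))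
        rcases hef.eq_or_lt with rfl | hlt
        · rw [hYf]; exact hone
        · exact hYp e he hlt

theorem activeWith_true_iff (N : OrientedMatroid E) :
    ActiveWith N S K n (fun _ => True) b e ↔
      ActiveWith N S K n (0 ≤ ·) b e ∨ ActiveWith N S K n (· ≤ 0) b e := by
  constructor
  · rintro ⟨X, h1, h2, h3, h4, -, h5⟩
    rcases le_total 0 (X n) with h | h
    · exact Or.inl ⟨X, h1, h2, h3, h4, h, h5⟩
    · exact Or.inr ⟨X, h1, h2, h3, h4, h, h5⟩
  · rintro (h | h) <;> exact h.mono fun _ _ => trivial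

/-- Of the two orientations of `n`, one behaves like the deletion and the other like the
contraction of `n`. -/
theorem activeWith_dichotomy [Finite E] (N : OrientedMatroid E) (S K : Finset E) (n : E) :
    (∀ b, ∀ e ∈ S,
      (ActiveWith N S K n (0 ≤ ·) b e ↔ ActiveWith N S K n (· = 0) b e) ∧
      (ActiveWith N S K n (· ≤ 0) b e ↔ ActiveWith N S K n (fun _ => True) b e)) ∨
    (∀ b, ∀ e ∈ S,
      (ActiveWith N S K n (· ≤ 0) b e ↔ ActiveWith N S K n (· = 0) b e) ∧
      (ActiveWith N S K n (0 ≤ ·) b e ↔ ActiveWith N S K n (fun _ => True) b e)) := by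
  have h1 : ∀ b e, ActiveWith N S K n (· = 0) b e → ActiveWith N S K n (0 ≤ ·) b e :=
    fun b e h => h.mono fun _ h => h.ge
  have h2 : ∀ b e, ActiveWith N S K n (· = 0) b e → ActiveWith N S K n (· ≤ 0) b e :=
    fun b e h => h.mono fun _ h => h.le
  by_cases hcase : ∀ b, ∀ e ∈ S, ActiveWith N S K n (0 ≤ ·) b e → ActiveWith N S K n (· = 0) b e
  · refine Or.inl fun b e he => ⟨⟨hcase b e he, h1 b e⟩, ?_⟩
    rw [activeWith_true_iff]
    exact ⟨Or.inr, fun h => h.elim (fun h => h2 b e (hcase b e he h)) id⟩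
  -- A single activity that needs `n` to be positive forces, by the elimination lemma, every
  -- activity with `n` nonpositive to have a witness vanishing at `n`. This makes the alternative
  -- uniform in `b` and `e`.
  · push Not at hcase
    obtain ⟨b₀, e₀, he₀, h₀, h₀'⟩ := hcase
    have hcase' : ∀ b, ∀ e ∈ S,
        ActiveWith N S K n (· ≤ 0) b e → ActiveWith N S K n (· = 0) b e := fun b e he h =>
      (activeWith_eq_zero_of_nonneg_of_nonpos N he₀ he h₀ h).resolve_left h₀'
    refine Or.inr fun b e he => ⟨⟨hcase' b e he, h2 b e⟩, ?_⟩
    rw [activeWith_true_iff]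
    exact ⟨Or.inl, fun h => h.elim id fun h => h1 b e (hcase' b e he h)⟩

variable [Fintype E]

theorem exists_reorient_circuit_iff (A : Finset E) {T : Set E} (hn : n ∉ T) :
    (∃ X ∈ (M.reorient A).circuits, X n = 1 ∧ ∀ h, X h ≠ 0 → h = n ∨ h ∈ T) ↔
      n ∈ M.toMatroid.closure T := by
  rw [toMatroid_mem_closure_iff _ hn]
  constructor
  · rintro ⟨X, hX, hXn, hXs⟩
    exact ⟨signReverse A X, hX, by simp [signReverse_ne_zero, hXn],
      fun h hh => hXs h ((signReverse_ne_zero A X h).1 hh)⟩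
  · rintro ⟨X, hX, hXn, hXs⟩
    have h1 : signReverse A X ∈ (M.reorient A).circuits := by
      rwa [mem_reorient_circuits, signReverse_signReverse]
    have h2 := (signReverse_ne_zero A X n).2 hXn
    have h3 : signReverse A X n = 1 ∨ signReverse A X n = -1 := by
      revert h2; generalize signReverse A X n = a; revert a; decide
    rcases h3 with h3 | h3
    · exact ⟨_, h1, h3, fun h hh => hXs h ((signReverse_ne_zero A X h).1 hh)⟩
    · refine ⟨_, (M.reorient A).neg_mem _ h1, by simp [h3], fun h hh => hXs h ?_⟩
      refine (signReverse_ne_zero A X h).1 fun h0 => hh ?_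
      simp [h0]

/-- A witness must vanish on `S`, all of which lies below `n`; so the condition says that `n` is a
loop of the minor. -/
theorem active_true_self_iff (hn : ∀ s ∈ S, s < n) (hnK : n ∉ K) (hSK : Disjoint S K) :
    M.Active (insert n S) K A true n ↔ n ∈ M.toMatroid.closure K := by
  rw [← M.exists_reorient_circuit_iff A (by simpa using hnK)]
  refine exists_congr fun X => and_congr_right fun _ => and_congr_right fun _ => ?_
  constructor
  · rintro ⟨-, h0, hs⟩ h hh
    rcases hs h hh with h1 | h1
    · rcases Finset.mem_insert.1 h1 with h2 | h2
      · exact Or.inl h2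
      · exact absurd (h0 rfl h h1 (hn h h2)) hh
    · exact Or.inr h1
  · refine fun hs => ⟨fun h hh hlt => ?_, fun _ h hh hlt => ?_, fun h hh => ?_⟩
    · rcases Finset.mem_insert.1 hh with h1 | h1
      · exact absurd h1 hlt.ne'
      · exact absurd (hn h h1) hlt.not_gt
    · by_contra hX
      rcases hs h hX with h1 | h1
      · exact hlt.ne h1
      · exact Finset.disjoint_left.1 hSK ((Finset.mem_insert.1 hh).resolve_left hlt.ne) h1
    · rcases hs h hh with h1 | h1
      · exact Or.inl (by simp [h1])
      · exact Or.inr h1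

/-- Nothing in `S` lies above `n`, so no sign is constrained except at `n`: the condition says that
`n` is not a coloop of the minor. -/
theorem active_false_self_iff (hn : ∀ s ∈ S, s < n) (hnK : n ∉ K) :
    M.Active (insert n S) K A false n ↔ n ∈ M.toMatroid.closure (S ∪ K) := by
  rw [← M.exists_reorient_circuit_iff A
    (by simpa using ⟨fun h => (hn n h).false, hnK⟩)]
  refine exists_congr fun X => and_congr_right fun _ => and_congr_right fun _ => ?_
  constructor
  · rintro ⟨-, -, hs⟩ h hh
    simpa [or_assoc] using hs h hh
  · refine fun hs => ⟨fun h hh hlt => ?_, by simp, fun h hh => ?_⟩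
    · rcases Finset.mem_insert.1 hh with h1 | h1
      · exact absurd h1 hlt.ne'
      · exact absurd (hn h h1) hlt.not_gt
    · simpa [or_assoc] using hs h hh

end Activity

end OrientedMatroid

namespace OrientedMatroid

/-! ### The four variable expansion of the Tutte polynomial -/

section Expansion

variable {E : Type*} [LinearOrder E]

open Classical in
/-- The contribution of a reorientation `A` with activities `P` to the expansion of the Tutte
polynomial in four variables. -/
noncomputable def activityWeight (x u y v : ℤ) (S A : Finset E) (P : Bool → E → Prop) : ℤ :=
  ∏ e ∈ S, ((if P true e then (if e ∈ A then v else y) else 1) *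
    (if P false e then 1 else (if e ∈ A then u else x)))

open Classical in
theorem activityWeight_congr {x u y v : ℤ} {S A B : Finset E} {P Q : Bool → E → Prop}
    (hAB : ∀ e ∈ S, e ∈ A ↔ e ∈ B) (hPQ : ∀ b, ∀ e ∈ S, P b e ↔ Q b e) :
    activityWeight x u y v S A P = activityWeight x u y v S B Q :=
  Finset.prod_congr rfl fun e he => congrArg₂ (· * ·)
    (if_congr (hPQ true e he) (if_congr (hAB e he) rfl rfl) rfl)
    (if_congr (hPQ false e he) rfl (if_congr (hAB e he) rfl rfl))

variable [Fintype E] (M : OrientedMatroid E)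

open Classical in
/-- The four variable expansion of the Tutte polynomial of a minor in terms of the activities of
its reorientations. -/
theorem sum_activityWeight (x u y v : ℤ) (S : Finset E) : ∀ K : Finset E, Disjoint S K →
    ∑ A ∈ S.powerset, activityWeight x u y v S A (M.Active S K A) =
      minorTutte M.toMatroid (x + u - 1) (y + v - 1) S K := by
  induction S using Finset.induction_on_max with
  | empty => intro K _; simp [activityWeight, minorTutte_empty]
  | insert n S hn ih =>
    intro K hSK
    rw [Finset.disjoint_insert_left] at hSK
    obtain ⟨hnK, hSK⟩ := hSK
    have hnS : n ∉ S := fun h => (hn n h).false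
    have hnA : ∀ A ∈ S.powerset, n ∉ A := fun A hA h => hnS (Finset.mem_powerset.1 hA h)
    rw [Finset.sum_powerset_insert hnS]
    -- split off the factor at `n`
    have hw : ∀ A ∈ S.powerset, activityWeight x u y v (insert n S) A (M.Active (insert n S) K A) =
        ((if n ∈ M.toMatroid.closure K then y else 1) *
          (if n ∈ M.toMatroid.closure (S ∪ K) then 1 else x)) *
        activityWeight x u y v S A (ActiveWith (M.reorient A) S K n (0 ≤ ·)) := by
      intro A hA
      rw [activityWeight, Finset.prod_insert hnS]
      exact congrArg₂ (· * ·) (congrArg₂ (· * ·)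
        (if_congr (M.active_true_self_iff hn hnK hSK) (if_neg (hnA A hA)) rfl)
        (if_congr (M.active_false_self_iff hn hnK) rfl (if_neg (hnA A hA))))
        (activityWeight_congr (fun _ _ => Iff.rfl) fun b e he => M.active_insert_iff b hn he)
    have hw' : ∀ A ∈ S.powerset, activityWeight x u y v (insert n S) (insert n A)
          (M.Active (insert n S) K (insert n A)) =
        ((if n ∈ M.toMatroid.closure K then v else 1) *
          (if n ∈ M.toMatroid.closure (S ∪ K) then 1 else u)) *
        activityWeight x u y v S A (ActiveWith (M.reorient A) S K n (· ≤ 0)) := by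
      intro A hA
      rw [activityWeight, Finset.prod_insert hnS]
      exact congrArg₂ (· * ·) (congrArg₂ (· * ·)
        (if_congr (M.active_true_self_iff hn hnK hSK) (if_pos (Finset.mem_insert_self n A)) rfl)
        (if_congr (M.active_false_self_iff hn hnK) rfl (if_pos (Finset.mem_insert_self n A))))
        (activityWeight_congr (fun e he => by simp [(hn e he).ne])
          fun b e he => M.active_insert_insert_iff b hn (hnA A hA) he)
    have hd : ∀ A, activityWeight x u y v S A (M.Active S K A) =
        activityWeight x u y v S A (ActiveWith (M.reorient A) S K n (· = 0)) := fun A =>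
      activityWeight_congr (fun _ _ => Iff.rfl) fun b e _ => M.active_iff_activeWith_eq b hnS hnK
    have hc : ∀ A, activityWeight x u y v S A (M.Active S (insert n K) A) =
        activityWeight x u y v S A (ActiveWith (M.reorient A) S K n (fun _ => True)) := fun A =>
      activityWeight_congr (fun _ _ => Iff.rfl) fun b e _ => M.active_insert_right_iff b
    rw [Finset.sum_congr rfl hw, Finset.sum_congr rfl hw']
    -- if signs at `n` do not matter, all the activities agree
    have hall : (∀ A b, ∀ e ∈ S, ActiveWith (M.reorient A) S K n (fun _ => True) b e →
        ActiveWith (M.reorient A) S K n (· = 0) b e) → ∀ A,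
        activityWeight x u y v S A (ActiveWith (M.reorient A) S K n (0 ≤ ·)) =
          activityWeight x u y v S A (M.Active S K A) ∧
        activityWeight x u y v S A (ActiveWith (M.reorient A) S K n (· ≤ 0)) =
          activityWeight x u y v S A (M.Active S K A) := by
      intro h A
      rw [hd]
      exact ⟨activityWeight_congr (fun _ _ => Iff.rfl) fun b e he =>
          ⟨fun h' => h A b e he (h'.mono fun _ _ => trivial), fun h' => h'.mono fun _ h => h.ge⟩,
        activityWeight_congr (fun _ _ => Iff.rfl) fun b e he =>
          ⟨fun h' => h A b e he (h'.mono fun _ _ => trivial), fun h' => h'.mono fun _ h => h.le⟩⟩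
    by_cases hloop : n ∈ M.toMatroid.closure K
    · have hcl : n ∈ M.toMatroid.closure (S ∪ K) :=
        M.toMatroid.closure_subset_closure Set.subset_union_right hloop
      have h := hall fun A b e he ⟨X, hX, hXe, hXp, hXz, _, hXs⟩ => by
        by_cases hXn : X n = 0
        · exact ⟨X, hX, hXe, hXp, hXz, hXn, hXs⟩
        obtain ⟨L, hL, hLn, hLs⟩ := (M.exists_reorient_circuit_iff A (by simpa using hnK)).2 hloop
        have hLS : ∀ h ∈ S, L h = 0 := by
          intro h hh
          by_contra hLh
          rcases hLs h hLh with h1 | h1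
          · exact hnS (h1 ▸ hh)
          · exact Finset.disjoint_left.1 hSK hh h1
        -- A loop of the minor comes from a circuit `L` inside `K ∪ {n}`. With its sign chosen
        -- opposite to `X` at `n`, it removes `n` from `X` without introducing new signs on `S`.
        obtain ⟨L, hL, hLn, hLs, hLS⟩ : ∃ L ∈ (M.reorient A).circuits, L n = -X n ∧
            (∀ h, L h ≠ 0 → h = n ∨ h ∈ K) ∧ ∀ h ∈ S, L h = 0 := by
          have h3 : X n = -1 ∨ X n = 1 := by
            revert hXn; generalize X n = a; revert a; decide
          rcases h3 with h3 | h3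
          · exact ⟨L, hL, by rw [h3, hLn]; rfl, hLs, hLS⟩
          · refine ⟨-L, (M.reorient A).neg_mem L hL, by rw [h3, Pi.neg_apply, hLn],
              fun h hh => hLs h fun h0 => hh (by simp [h0]), fun h hh => by simp [hLS h hh]⟩
        obtain ⟨Z, hZ, hZn, hZe, hZs⟩ := (M.reorient A).eliminatesKeeping_of_ne_zero _ X hX L hL
          rfl n e hXn hLn (by simp [hXe]) (by rw [hLS e he, hXe]; decide)
        have hZX : ∀ h ∈ S, Z h = 0 ∨ Z h = X h := fun h hh => by
          have := hZs h
          rw [hLS h hh] at this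
          tauto
        refine ⟨Z, hZ, ?_, fun h hh hlt => ?_, fun hb h hh hlt => ?_, hZn, fun h hh => ?_⟩
        · rw [(hZX e he).resolve_left hZe, hXe]
        · rcases hZX h hh with h1 | h1 <;> rw [h1]
          exact hXp h hh hlt
        · have := hZX h hh
          rwa [hXz hb h hh hlt, or_self] at this
        · rcases hZs h with h1 | h1 | h1 <;> rw [h1] at hh
          exacts [absurd rfl hh, hXs h hh, (hLs h hh).imp_right Or.inr]
      rw [minorTutte_insert_of_loop _ _ hnS hloop, ← ih K hSK]
      simp only [hloop, hcl, if_true, h, mul_one, ← Finset.mul_sum]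
      ring
    by_cases hcl : n ∈ M.toMatroid.closure (S ∪ K)
    · rw [minorTutte_insert _ _ hnS (Set.mem_univ n) hcl hloop, ← ih K hSK,
        ← ih (insert n K) (Finset.disjoint_insert_right.2 ⟨hnS, hSK⟩)]
      simp only [hloop, hcl, if_true, if_false, mul_one, one_mul, hd, hc,
        ← Finset.sum_add_distrib]
      refine Finset.sum_congr rfl fun A _ => ?_
      -- The terms of `A` and `insert n A` are those of the deletion and the contraction, in an
      -- order that depends on `A`.
      rcases activeWith_dichotomy (M.reorient A) S K n with h | h
      · exact congrArg₂ _ (activityWeight_congr (fun _ _ => Iff.rfl) fun b e he => (h b e he).1)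
          (activityWeight_congr (fun _ _ => Iff.rfl) fun b e he => (h b e he).2)
      · rw [add_comm]
        exact congrArg₂ _ (activityWeight_congr (fun _ _ => Iff.rfl) fun b e he => (h b e he).1)
          (activityWeight_congr (fun _ _ => Iff.rfl) fun b e he => (h b e he).2)
    -- For a coloop of the minor, no circuit supported in `S ∪ K ∪ {n}` contains `n`.
    · have h := hall fun A b e he ⟨X, hX, hXe, hXp, hXz, _, hXs⟩ => by
        refine ⟨X, hX, hXe, hXp, hXz, ?_, hXs⟩
        by_contra hXn
        refine hcl ((M.toMatroid_mem_closure_iff (by simpa using ⟨hnS, hnK⟩)).2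
          ⟨signReverse A X, hX, (signReverse_ne_zero A X n).2 hXn, fun h hh => ?_⟩)
        exact hXs h ((signReverse_ne_zero A X h).1 hh)
      rw [minorTutte_insert_of_coloop _ _ hnS (Set.mem_univ n) hcl, ← ih K hSK]
      simp only [hloop, hcl, if_false, h, one_mul, ← Finset.mul_sum]
      ring

theorem tutte_eq_minorTutte (x y : ℤ) :
    M.tutte x y = minorTutte M.toMatroid (x - 1) (y - 1) Finset.univ ∅ := by
  have h0 : matroidRank M.toMatroid (∅ : Set E) = 0 := by simp [matroidRank]
  simp [tutte, tuttePolynomial, minorTutte, Polynomial.evalEval, Polynomial.eval_finsetSum, h0]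

-- Used with `x, u, y, v` equal to 0 or 1. Taking `v = 0` discards each `A` that contains an active
-- element, `u = 0` each `A` that contains a dually active one; `y = v = 0` forbids active elements
-- altogether and `x = u = 0` dually active ones. The remaining variables are 1.
open Classical in
theorem ncard_eq_tutte (x u y v : ℤ) {s t : ℤ} (hs : x + u = s) (ht : y + v = t)
    {P : Finset E → Prop} (Q : Finset E → E → Prop) (hP : ∀ A, P A ↔ ∀ e, Q A e)
    (hQ : ∀ A e, (if M.Active Finset.univ ∅ A true e then (if e ∈ A then v else y) else 1) *
      (if M.Active Finset.univ ∅ A false e then 1 else (if e ∈ A then u else x)) =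
        if Q A e then 1 else 0) :
    (({A | P A} : Set (Finset E)).ncard : ℤ) = M.tutte s t := by
  subst hs ht
  simp only [hP]
  rw [tutte_eq_minorTutte, ← sum_activityWeight _ _ _ _ _ _ _ (Finset.disjoint_empty_right _)]
  simp only [activityWeight, hQ, Finset.prod_boole, Finset.powerset_univ, Finset.mem_univ,
    forall_const, Finset.sum_boole]
  rw [Set.ncard_eq_toFinset_card']
  simp

end Expansion

/-! ### Orthogonality and sign reversal -/

section Orthogonality

variable {E : Type*}

theorem signOrthogonal_comm {X Y : E → SignType} : SignOrthogonal X Y ↔ SignOrthogonal Y X := by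
  simp only [SignOrthogonal, mul_comm]

theorem signOrthogonal_neg_right {X Y : E → SignType} (h : SignOrthogonal X Y) :
    SignOrthogonal X (-Y) := by
  have hs : ∀ a b : SignType, (a * b = 1 → a * -b = -1) ∧ (a * b = -1 → a * -b = 1) ∧
    (a * b = 0 → a * -b = 0) := by decide
  rcases h with h | ⟨⟨e, he⟩, f, hf⟩
  · exact Or.inl fun e => (hs _ _).2.2 (h e)
  · exact Or.inr ⟨⟨f, (hs _ _).2.1 hf⟩, e, (hs _ _).1 he⟩

variable [DecidableEq E]

theorem exists_neg_of_signOrthogonal {X : E → SignType} {D : Finset E} {e : E}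
    (h : SignOrthogonal X (positiveVector D)) (he : e ∈ D) (hX : X e = 1) :
    ∃ f ∈ D, X f = -1 := by
  rcases h with h | ⟨-, f, hf⟩
  · have := h e
    simp [positiveVector, he, hX] at this
  · by_cases hfD : f ∈ D
    · exact ⟨f, hfD, by simpa [positiveVector, hfD] using hf⟩
    · simp [positiveVector, hfD] at hf

/-- A common element would require another one with opposite signs, which two nonnegative vectors do
not have. -/
theorem disjoint_of_signOrthogonal {C D : Finset E}
    (h : SignOrthogonal (positiveVector C) (positiveVector D)) : Disjoint C D := by
  rw [Finset.disjoint_left]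
  intro e heC heD
  obtain ⟨f, -, hf⟩ := exists_neg_of_signOrthogonal h heD (by simp [positiveVector, heC])
  revert hf; unfold positiveVector; split <;> decide

theorem signReverse_positiveVector_of_disjoint {C D : Finset E} (h : Disjoint C D) :
    signReverse C (positiveVector D) = positiveVector D := by
  funext e
  by_cases he : e ∈ C
  · simp [signReverse, positiveVector, Finset.disjoint_left.1 h he]
  · simp [signReverse, he]

theorem signReverse_positiveVector_self (C : Finset E) :
    signReverse C (positiveVector C) = -positiveVector C := by
  funext e
  by_cases he : e ∈ C <;> simp [signReverse, positiveVector, he]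

theorem signReverse_symmDiff (C A : Finset E) (X : E → SignType) :
    signReverse (C ∆ A) X = signReverse A (signReverse C X) := by
  funext e
  by_cases h1 : e ∈ C <;> by_cases h2 : e ∈ A <;> simp [signReverse, Finset.mem_symmDiff, h1, h2]

theorem signOrthogonal_signReverse_iff (A : Finset E) (X Y : E → SignType) :
    SignOrthogonal (signReverse A X) (signReverse A Y) ↔ SignOrthogonal X Y := by
  have h : ∀ e, signReverse A X e * signReverse A Y e = X e * Y e := by
    intro e; by_cases he : e ∈ A <;> simp [signReverse, he]
  simp only [SignOrthogonal, h]

/-- If reversing `C` in `positiveVector D` gives something orthogonal to `positiveVector C`, then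
`C` and `D` are disjoint. -/
theorem disjoint_of_signOrthogonal_signReverse {C D : Finset E}
    (h : SignOrthogonal (positiveVector C) (signReverse C (positiveVector D))) : Disjoint C D := by
  rw [← signOrthogonal_signReverse_iff C, signReverse_signReverse, signReverse_positiveVector_self,
    signOrthogonal_comm] at h
  have := signOrthogonal_neg_right h
  rw [neg_neg] at this
  exact (disjoint_of_signOrthogonal this).symm

end Orthogonality

/-! ### Effect of reversals on positive circuits and cocircuits -/

section Reversal

variable {E : Type*} [DecidableEq E] (M : OrientedMatroid E) (A : Finset E)

variable {M A} in
theorem mem_reorient_symmDiff_circuits (C : Finset E) (X : E → SignType) :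
    X ∈ (M.reorient (C ∆ A)).circuits ↔ signReverse C X ∈ (M.reorient A).circuits := by
  rw [mem_reorient_circuits, mem_reorient_circuits, signReverse_symmDiff]

variable {M A} in
theorem IsPositiveCircuit.symmDiff {C : Finset E} (h : (M.reorient A).IsPositiveCircuit C) :
    (M.reorient (C ∆ A)).IsPositiveCircuit C := by
  rw [IsPositiveCircuit, mem_reorient_symmDiff_circuits, signReverse_positiveVector_self]
  exact neg_mem _ _ h

theorem IsPositiveCircuit.nonempty {N : OrientedMatroid E} {C : Finset E}
    (h : N.IsPositiveCircuit C) : C.Nonempty := by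
  rw [Finset.nonempty_iff_ne_empty]
  rintro rfl
  have h0 : positiveVector (∅ : Finset E) = 0 := by funext e; simp [positiveVector]
  exact N.zero_notMem (h0 ▸ h)

variable [Fintype E]

theorem toMatroid_reorient : (M.reorient A).toMatroid = M.toMatroid := by
  refine Matroid.ext_indep rfl fun I _ => ?_
  rw [toMatroid_indep_iff_set, toMatroid_indep_iff_set]
  constructor
  · intro h X hX
    have := h (signReverse A X) (by rwa [mem_reorient_circuits, signReverse_signReverse])
    rwa [support_signReverse] at this
  · intro h X hX
    rw [← support_signReverse A]
    exact h _ hX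

theorem mem_reorient_cocircuits (Y : E → SignType) :
    Y ∈ (M.reorient A).cocircuits ↔ signReverse A Y ∈ M.cocircuits := by
  unfold cocircuits
  rw [Set.mem_ofPred_eq, Set.mem_ofPred_eq, toMatroid_reorient, support_signReverse]
  refine and_congr_right fun _ => ⟨fun h X hX => ?_, fun h X hX => ?_⟩
  · rw [← signOrthogonal_signReverse_iff A, signReverse_signReverse]
    exact h _ (by rwa [mem_reorient_circuits, signReverse_signReverse])
  · rw [← signOrthogonal_signReverse_iff A]
    exact h _ hX

theorem neg_mem_cocircuits {Y : E → SignType} (hY : Y ∈ M.cocircuits) : -Y ∈ M.cocircuits := by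
  refine ⟨?_, fun X hX => signOrthogonal_neg_right (hY.2 X hX)⟩
  convert hY.1 using 1
  ext e; cases h : Y e <;> simp [h]

variable {M A}

theorem mem_reorient_symmDiff_cocircuits (C : Finset E) (Y : E → SignType) :
    Y ∈ (M.reorient (C ∆ A)).cocircuits ↔ signReverse C Y ∈ (M.reorient A).cocircuits := by
  rw [mem_reorient_cocircuits, mem_reorient_cocircuits, signReverse_symmDiff]

theorem IsPositiveCocircuit.symmDiff {C : Finset E} (h : (M.reorient A).IsPositiveCocircuit C) :
    (M.reorient (C ∆ A)).IsPositiveCocircuit C := by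
  rw [IsPositiveCocircuit, mem_reorient_symmDiff_cocircuits, signReverse_positiveVector_self]
  exact neg_mem_cocircuits _ h

/-- Orthogonality makes `C` and `D` disjoint, whether `D` is positive before or after the reversal,
so reversing `C` does not touch `D`. -/
theorem IsPositiveCircuit.isPositiveCocircuit_symmDiff_iff {C D : Finset E}
    (h : (M.reorient A).IsPositiveCircuit C) :
    (M.reorient (C ∆ A)).IsPositiveCocircuit D ↔ (M.reorient A).IsPositiveCocircuit D := by
  unfold IsPositiveCocircuit
  rw [mem_reorient_symmDiff_cocircuits]
  constructor
  · intro hD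
    rwa [signReverse_positiveVector_of_disjoint
      (disjoint_of_signOrthogonal_signReverse (hD.2 _ h))] at hD
  · intro hD
    rwa [signReverse_positiveVector_of_disjoint (disjoint_of_signOrthogonal (hD.2 _ h))]

theorem IsPositiveCocircuit.isPositiveCircuit_symmDiff_iff {C D : Finset E}
    (h : (M.reorient A).IsPositiveCocircuit D) :
    (M.reorient (D ∆ A)).IsPositiveCircuit C ↔ (M.reorient A).IsPositiveCircuit C := by
  unfold IsPositiveCircuit
  rw [mem_reorient_symmDiff_circuits]
  constructor
  · intro hC
    rwa [signReverse_positiveVector_of_disjoint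
      (disjoint_of_signOrthogonal_signReverse (signOrthogonal_comm.1 (h.2 _ hC)))] at hC
  · intro hC
    rwa [signReverse_positiveVector_of_disjoint (disjoint_of_signOrthogonal (h.2 _ hC)).symm]

theorem IsPositiveCocircuit.nonempty {N : OrientedMatroid E} {C : Finset E}
    (h : N.IsPositiveCocircuit C) : C.Nonempty := by
  obtain ⟨e, he⟩ := h.1.nonempty
  refine ⟨e, ?_⟩
  by_contra hC
  simp [positiveVector, hC] at he

/-- A nonnegative signed circuit is the positive circuit on its support. -/
theorem exists_isPositiveCircuit_of_nonneg {N : OrientedMatroid E} {X : E → SignType}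
    (hX : X ∈ N.circuits) (h0 : ∀ h, 0 ≤ X h) :
    N.IsPositiveCircuit (Finset.univ.filter fun h => X h = 1) := by
  have hXeq : positiveVector (Finset.univ.filter fun h => X h = 1) = X := by
    funext h
    have := h0 h
    simp only [positiveVector, Finset.mem_filter, Finset.mem_univ, true_and]
    revert this; generalize X h = a; revert a; decide
  rwa [IsPositiveCircuit, hXeq]

/-- Disjointness gives one direction. The other is Farkas' lemma with no unconstrained elements. -/
theorem isTotallyCyclic_iff {N : OrientedMatroid E} :
    N.IsTotallyCyclic ↔ ∀ D, ¬ N.IsPositiveCocircuit D := by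
  constructor
  · intro h D hD
    obtain ⟨e, he⟩ := hD.nonempty
    obtain ⟨C, hC, heC⟩ := h e
    exact Finset.disjoint_left.1 (disjoint_of_signOrthogonal (hD.2 _ hC)) heC he
  · intro h e
    by_contra hcon
    obtain ⟨D, hD, -⟩ := N.exists_isPositiveCocircuit ∅ (Finset.notMem_empty e)
      (by
        rintro ⟨X, hX, hXe, hX0⟩
        exact hcon ⟨_, exists_isPositiveCircuit_of_nonneg hX fun h => hX0 h (by simp),
          by simpa using hXe⟩)
    exact h D hD

/-- A reversed positive circuit is positive again, so neither side of a circuit reversal is acyclic.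
A cocircuit reversal preserves all positive circuits. -/
theorem isAcyclic_iff_of_reversal {A B : Finset E}
    (h : M.CircuitReversal A B ∨ M.CocircuitReversal A B) :
    (M.reorient A).IsAcyclic ↔ (M.reorient B).IsAcyclic := by
  rcases h with ⟨C, hC, rfl⟩ | ⟨D, hD, rfl⟩
  · exact iff_of_false (fun h => h C hC) (fun h => h C hC.symmDiff)
  · simp only [IsAcyclic, hD.isPositiveCircuit_symmDiff_iff]

theorem isTotallyCyclic_iff_of_reversal {A B : Finset E}
    (h : M.CircuitReversal A B ∨ M.CocircuitReversal A B) :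
    (M.reorient A).IsTotallyCyclic ↔ (M.reorient B).IsTotallyCyclic := by
  simp only [isTotallyCyclic_iff]
  rcases h with ⟨C, hC, rfl⟩ | ⟨D, hD, rfl⟩
  · simp only [hC.isPositiveCocircuit_symmDiff_iff]
  · exact iff_of_false (fun h => h D hD) (fun h => h D hD.symmDiff)

end Reversal

/-! ### Counting minimal reorientations -/

section Minimal

variable {E : Type*} [LinearOrder E] (M : OrientedMatroid E) (A : Finset E)

variable {M A} in
theorem IsAcyclic.circuitMinimal (h : (M.reorient A).IsAcyclic) : M.CircuitMinimal A :=
  fun C hC => absurd hC (h C)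

variable [Fintype E]

theorem active_true_iff (e : E) : M.Active Finset.univ ∅ A true e ↔
    ∃ C, (M.reorient A).IsPositiveCircuit C ∧ IsLeast (C : Set E) e := by
  constructor
  · rintro ⟨X, hX, hXe, hXp, hXz, -⟩
    refine ⟨_, exists_isPositiveCircuit_of_nonneg hX fun h => ?_, by simpa using hXe, fun h hh => ?_⟩
    · rcases lt_trichotomy h e with h1 | rfl | h1
      · rw [hXz rfl h (Finset.mem_univ _) h1]
      · rw [hXe]; decide
      · exact hXp h (Finset.mem_univ _) h1
    · by_contra hlt
      have h1 := hXz rfl h (Finset.mem_univ _) (not_le.1 hlt)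
      simp [h1] at hh
  · rintro ⟨C, hC, heC, hmin⟩
    refine ⟨_, hC, by simpa [positiveVector] using heC, fun h _ _ => ?_, fun _ h _ hlt => ?_,
      by simp⟩
    · unfold positiveVector; split <;> decide
    · have : h ∉ C := fun hh => hlt.not_ge (hmin hh)
      simp [positiveVector, this]

/-- Farkas' lemma with the elements below `e` unconstrained: the resulting cocircuit contains `e`
and avoids everything smaller. Conversely, orthogonality would make a witness negative at some
element of the cocircuit other than `e`, hence above `e`. -/
theorem not_active_false_iff (e : E) : ¬ M.Active Finset.univ ∅ A false e ↔
    ∃ C, (M.reorient A).IsPositiveCocircuit C ∧ IsLeast (C : Set E) e := by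
  constructor
  · intro h
    obtain ⟨D, hD, heD, hdis⟩ := (M.reorient A).exists_isPositiveCocircuit
      (Finset.univ.filter (· < e)) (e := e) (by simp) (by
        rintro ⟨X, hX, hXe, hX0⟩
        exact h ⟨X, hX, hXe, fun f _ hf => hX0 f (by simpa using hf.le), by simp, by simp⟩)
    refine ⟨D, hD, heD, fun f hf => ?_⟩
    simpa using Finset.disjoint_left.1 hdis hf
  · rintro ⟨C, hC, heC, hmin⟩ ⟨X, hX, hXe, hXp, -⟩
    obtain ⟨f, hf, hXf⟩ := exists_neg_of_signOrthogonal (hC.2 X hX) heC hXe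
    rcases (hmin hf).eq_or_lt with h1 | h1
    · rw [← h1, hXe] at hXf
      exact absurd hXf (by decide)
    · have := hXp f (Finset.mem_univ _) h1
      rw [hXf] at this
      exact absurd this (by decide)

theorem circuitMinimal_iff :
    M.CircuitMinimal A ↔ ∀ e, M.Active Finset.univ ∅ A true e → e ∉ A := by
  simp only [CircuitMinimal, active_true_iff]
  exact ⟨fun h e ⟨C, hC, he⟩ => h C hC e he, fun h C hC e he => h e ⟨C, hC, he⟩⟩

theorem cocircuitMinimal_iff :
    M.CocircuitMinimal A ↔ ∀ e, ¬ M.Active Finset.univ ∅ A false e → e ∉ A := by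
  simp only [CocircuitMinimal, not_active_false_iff]
  exact ⟨fun h e ⟨C, hC, he⟩ => h C hC e he, fun h C hC e he => h e ⟨C, hC, he⟩⟩

theorem isAcyclic_iff_forall_not_active :
    (M.reorient A).IsAcyclic ↔ ∀ e, ¬ M.Active Finset.univ ∅ A true e := by
  simp only [IsAcyclic, active_true_iff]
  refine ⟨fun h e ⟨C, hC, _⟩ => h C hC, fun h C hC => ?_⟩
  exact h _ ⟨C, hC, C.isLeast_min' hC.nonempty⟩

theorem isTotallyCyclic_iff_forall_active :
    (M.reorient A).IsTotallyCyclic ↔ ∀ e, M.Active Finset.univ ∅ A false e := by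
  rw [isTotallyCyclic_iff, ← not_iff_not]
  push Not
  simp only [not_active_false_iff]
  exact ⟨fun ⟨C, hC⟩ => ⟨_, C, hC, C.isLeast_min' hC.nonempty⟩, fun ⟨e, C, hC, _⟩ => ⟨C, hC⟩⟩

variable {M A}

theorem IsTotallyCyclic.cocircuitMinimal (h : (M.reorient A).IsTotallyCyclic) :
    M.CocircuitMinimal A :=
  fun C hC => absurd hC (isTotallyCyclic_iff.1 h C)

variable (M)

theorem ncard_circuitMinimal_and_cocircuitMinimal :
    (({A | M.CircuitMinimal A ∧ M.CocircuitMinimal A} : Set (Finset E)).ncard : ℤ) =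
      M.tutte 1 1 := by
  refine M.ncard_eq_tutte 1 0 1 0 rfl rfl (fun A e => (M.Active Finset.univ ∅ A true e → e ∉ A) ∧
    (¬ M.Active Finset.univ ∅ A false e → e ∉ A)) (fun A => ?_) ?_
  · rw [circuitMinimal_iff, cocircuitMinimal_iff, forall_and]
  · intro A e
    by_cases h1 : M.Active Finset.univ ∅ A true e <;>
      by_cases h2 : M.Active Finset.univ ∅ A false e <;> by_cases h3 : e ∈ A <;> simp [h1, h2, h3]

theorem ncard_cocircuitMinimal :
    (({A | M.CocircuitMinimal A} : Set (Finset E)).ncard : ℤ) = M.tutte 1 2 := by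
  refine M.ncard_eq_tutte 1 0 1 1 rfl rfl (fun A e => ¬ M.Active Finset.univ ∅ A false e → e ∉ A) (fun A => ?_) ?_
  · rw [cocircuitMinimal_iff]
  · intro A e
    by_cases h1 : M.Active Finset.univ ∅ A true e <;>
      by_cases h2 : M.Active Finset.univ ∅ A false e <;> by_cases h3 : e ∈ A <;> simp [h1, h2, h3]

theorem ncard_circuitMinimal :
    (({A | M.CircuitMinimal A} : Set (Finset E)).ncard : ℤ) = M.tutte 2 1 := by
  refine M.ncard_eq_tutte 1 1 1 0 rfl rfl (fun A e => M.Active Finset.univ ∅ A true e → e ∉ A) (fun A => ?_) ?_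
  · rw [circuitMinimal_iff]
  · intro A e
    by_cases h1 : M.Active Finset.univ ∅ A true e <;>
      by_cases h2 : M.Active Finset.univ ∅ A false e <;> by_cases h3 : e ∈ A <;> simp [h1, h2, h3]

theorem ncard_isAcyclic_and_cocircuitMinimal :
    (({A | (M.reorient A).IsAcyclic ∧ M.CocircuitMinimal A} : Set (Finset E)).ncard : ℤ) =
      M.tutte 1 0 := by
  -- `y = v = 0` excludes all active elements, which is acyclicity.
  refine M.ncard_eq_tutte 1 0 0 0 rfl rfl (fun A e => ¬ M.Active Finset.univ ∅ A true e ∧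
    (¬ M.Active Finset.univ ∅ A false e → e ∉ A)) (fun A => ?_) ?_
  · rw [isAcyclic_iff_forall_not_active, cocircuitMinimal_iff, forall_and]
  · intro A e
    by_cases h1 : M.Active Finset.univ ∅ A true e <;>
      by_cases h2 : M.Active Finset.univ ∅ A false e <;> by_cases h3 : e ∈ A <;> simp [h1, h2, h3]

theorem ncard_isTotallyCyclic_and_circuitMinimal :
    (({A | (M.reorient A).IsTotallyCyclic ∧ M.CircuitMinimal A} : Set (Finset E)).ncard : ℤ) =
      M.tutte 0 1 := by
  -- `x = u = 0` excludes all dually active elements, which is total cyclicity.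
  refine M.ncard_eq_tutte 0 0 1 0 rfl rfl (fun A e => M.Active Finset.univ ∅ A false e ∧
    (M.Active Finset.univ ∅ A true e → e ∉ A)) (fun A => ?_) ?_
  · rw [isTotallyCyclic_iff_forall_active, circuitMinimal_iff, forall_and]
  · intro A e
    by_cases h1 : M.Active Finset.univ ∅ A true e <;>
      by_cases h2 : M.Active Finset.univ ∅ A false e <;> by_cases h3 : e ∈ A <;> simp [h1, h2, h3]

end Minimal

/-! ### Reversal classes and their minimal members -/

section Classes

/-- If every class in `𝒦` contains an element satisfying `P`, and all elements satisfying `P` lie in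
classes in `𝒦`, then `𝒦` has at most as many members as there are elements satisfying `P`, with
equality if and only if no class contains two of them. -/
theorem ncard_classes_le_and_eq_iff {E : Type*} [Finite E] (s : Setoid (Finset E))
    {𝒦 : Set (Set (Finset E))} (h𝒦 : 𝒦 ⊆ s.classes) {P : Finset E → Prop}
    (hex : ∀ K ∈ 𝒦, ∃ A ∈ K, P A) (hmem : ∀ K ∈ s.classes, ∀ A ∈ K, P A → K ∈ 𝒦) {t : ℤ}
    (ht : (({A | P A} : Set (Finset E)).ncard : ℤ) = t) :
    (𝒦.ncard : ℤ) ≤ t ∧ ((𝒦.ncard : ℤ) = t ↔ NoTwoInSameClass P s.classes) := by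
  let f : Finset E → Set (Finset E) := fun A => {B | s B A}
  have hf : ∀ K ∈ s.classes, ∀ A ∈ K, f A = K := by
    rintro _ ⟨B, rfl⟩ A hA
    ext C
    exact ⟨fun h => s.trans h hA, fun h => s.trans h (s.symm hA)⟩
  have hself : ∀ A, A ∈ f A := fun A => s.refl A
  have himage : f '' {A | P A} = 𝒦 := by
    ext K
    constructor
    · rintro ⟨A, hA, rfl⟩
      exact hmem _ (s.mem_classes A) A (hself A) hA
    · intro hK
      obtain ⟨A, hA, hPA⟩ := hex K hK
      exact ⟨A, hPA, hf K (h𝒦 hK) A hA⟩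
  -- The classes in `𝒦` are the image of the elements satisfying `P`, so equality of cardinalities
  -- is injectivity of `f` on them.
  rw [← ht, Nat.cast_le, Nat.cast_inj, ← himage, Set.ncard_image_iff (Set.toFinite _)]
  refine ⟨Set.ncard_image_le (Set.toFinite _), fun h K hK A hA B hB hPA hPB => ?_,
    fun h A hPA B hPB hAB => ?_⟩
  · exact h hPA hPB ((hf K hK A hA).trans (hf K hK B hB).symm)
  · exact h _ (s.mem_classes A) A (hself A) B
      (show B ∈ f A from hAB ▸ hself B) hPA hPB

/-- If every `A` not satisfying `P` is related to some `C ∆ A` with `min C ∈ A`, then every class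
contains an element satisfying `P`: the lexicographically smallest one. -/
theorem exists_mem_class_of_descent {E : Type*} [LinearOrder E] [Finite E]
    {r : Finset E → Finset E → Prop} {P : Finset E → Prop}
    (hr : ∀ A, ¬ P A → ∃ (C : Finset E) (e : E), IsLeast (C : Set E) e ∧ e ∈ A ∧ r A (C ∆ A))
    {K : Set (Finset E)} (hK : K ∈ (Relation.EqvGen.setoid r).classes) : ∃ A ∈ K, P A := by
  obtain ⟨A₀, rfl⟩ := hK
  let f : Finset E → Lex (E → Bool) := fun A => toLex fun e => decide (e ∈ A)
  obtain ⟨A, hA, hmin⟩ := Set.exists_min_image {B | Relation.EqvGen.setoid r B A₀} f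
    (Set.toFinite _) ⟨A₀, (Relation.EqvGen.setoid r).refl A₀⟩
  refine ⟨A, hA, ?_⟩
  by_contra hP
  obtain ⟨C, e, ⟨heC, hle⟩, heA, hrA⟩ := hr A hP
  have hmem : Relation.EqvGen.setoid r (C ∆ A) A₀ :=
    (Relation.EqvGen.setoid r).trans (Relation.EqvGen.symm _ _ (Relation.EqvGen.rel _ _ hrA)) hA
  -- `A` and `C ∆ A` first differ at `e = min C`, which the reversal removes from `A`.
  refine (hmin _ hmem).not_gt ⟨e, fun g hg => ?_, ?_⟩
  · have : g ∉ C := fun h => hg.not_ge (hle h)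
    simp [f, Finset.mem_symmDiff, this]
  · have : e ∈ C := heC
    simp [f, Finset.mem_symmDiff, this, heA]

theorem iff_of_eqvGen {α : Type*} {r : α → α → Prop} {P : α → Prop}
    (h : ∀ a b, r a b → (P a ↔ P b)) {a b : α} (hab : Relation.EqvGen r a b) : P a ↔ P b := by
  induction hab with
  | rel a b hab => exact h a b hab
  | refl => rfl
  | symm _ _ _ ih => exact ih.symm
  | trans _ _ _ _ _ ih₁ ih₂ => exact ih₁.trans ih₂

/-- An invariant property holds on a whole class as soon as it holds for one member. -/
theorem forall_mem_class_of_mem {α : Type*} {r : α → α → Prop} {P : α → Prop}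
    (h : ∀ a b, r a b → (P a ↔ P b)) {K : Set α} (hK : K ∈ (Relation.EqvGen.setoid r).classes)
    {a : α} (ha : a ∈ K) (hPa : P a) : ∀ b ∈ K, P b := by
  obtain ⟨c, rfl⟩ := hK
  exact fun b hb => (iff_of_eqvGen h hb).2 ((iff_of_eqvGen h ha).1 hPa)

variable {E : Type*} [LinearOrder E] (M : OrientedMatroid E)

theorem exists_circuitReversal_of_not_circuitMinimal {A : Finset E} (h : ¬ M.CircuitMinimal A) :
    ∃ (C : Finset E) (e : E), IsLeast (C : Set E) e ∧ e ∈ A ∧ M.CircuitReversal A (C ∆ A) := by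
  unfold CircuitMinimal at h
  push Not at h
  obtain ⟨C, hC, e, he, heA⟩ := h
  exact ⟨C, e, he, heA, C, hC, rfl⟩

variable [Fintype E]

theorem exists_cocircuitReversal_of_not_cocircuitMinimal {A : Finset E}
    (h : ¬ M.CocircuitMinimal A) :
    ∃ (C : Finset E) (e : E), IsLeast (C : Set E) e ∧ e ∈ A ∧ M.CocircuitReversal A (C ∆ A) := by
  unfold CocircuitMinimal at h
  push Not at h
  obtain ⟨C, hC, e, he, heA⟩ := h
  exact ⟨C, e, he, heA, C, hC, rfl⟩

theorem exists_minimal_mem_circuitCocircuitClasses {K : Set (Finset E)}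
    (hK : K ∈ M.circuitCocircuitClasses) : ∃ A ∈ K, M.CircuitMinimal A ∧ M.CocircuitMinimal A := by
  refine exists_mem_class_of_descent (fun A h => ?_) hK
  rw [not_and_or] at h
  rcases h with h | h
  · obtain ⟨C, e, h1, h2, h3⟩ := M.exists_circuitReversal_of_not_circuitMinimal h
    exact ⟨C, e, h1, h2, Or.inl h3⟩
  · obtain ⟨C, e, h1, h2, h3⟩ := M.exists_cocircuitReversal_of_not_cocircuitMinimal h
    exact ⟨C, e, h1, h2, Or.inr h3⟩

theorem exists_minimal_mem_circuitClasses {K : Set (Finset E)} (hK : K ∈ M.circuitClasses) :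
    ∃ A ∈ K, M.CircuitMinimal A :=
  exists_mem_class_of_descent (fun _ => M.exists_circuitReversal_of_not_circuitMinimal) hK

theorem exists_minimal_mem_cocircuitClasses {K : Set (Finset E)} (hK : K ∈ M.cocircuitClasses) :
    ∃ A ∈ K, M.CocircuitMinimal A :=
  exists_mem_class_of_descent (fun _ => M.exists_cocircuitReversal_of_not_cocircuitMinimal) hK

theorem mem_acyclicPart_circuitCocircuitClasses {K : Set (Finset E)}
    (hK : K ∈ M.circuitCocircuitClasses) {A : Finset E} (hA : A ∈ K)
    (h : (M.reorient A).IsAcyclic) : K ∈ M.acyclicPart M.circuitCocircuitClasses :=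
  ⟨hK, forall_mem_class_of_mem (r := fun A B => M.CircuitReversal A B ∨ M.CocircuitReversal A B)
    (P := fun A => (M.reorient A).IsAcyclic)
    (fun _ _ h => isAcyclic_iff_of_reversal h) hK hA h⟩

theorem mem_acyclicPart_cocircuitClasses {K : Set (Finset E)}
    (hK : K ∈ M.cocircuitClasses) {A : Finset E} (hA : A ∈ K)
    (h : (M.reorient A).IsAcyclic) : K ∈ M.acyclicPart M.cocircuitClasses :=
  ⟨hK, forall_mem_class_of_mem (r := M.CocircuitReversal)
    (P := fun A => (M.reorient A).IsAcyclic)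
    (fun _ _ h => isAcyclic_iff_of_reversal (Or.inr h)) hK hA h⟩

theorem mem_totallyCyclicPart_circuitCocircuitClasses {K : Set (Finset E)}
    (hK : K ∈ M.circuitCocircuitClasses) {A : Finset E} (hA : A ∈ K)
    (h : (M.reorient A).IsTotallyCyclic) : K ∈ M.totallyCyclicPart M.circuitCocircuitClasses :=
  ⟨hK, forall_mem_class_of_mem (r := fun A B => M.CircuitReversal A B ∨ M.CocircuitReversal A B)
    (P := fun A => (M.reorient A).IsTotallyCyclic)
    (fun _ _ h => isTotallyCyclic_iff_of_reversal h) hK hA h⟩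

theorem mem_totallyCyclicPart_circuitClasses {K : Set (Finset E)}
    (hK : K ∈ M.circuitClasses) {A : Finset E} (hA : A ∈ K)
    (h : (M.reorient A).IsTotallyCyclic) : K ∈ M.totallyCyclicPart M.circuitClasses :=
  ⟨hK, forall_mem_class_of_mem (r := M.CircuitReversal)
    (P := fun A => (M.reorient A).IsTotallyCyclic)
    (fun _ _ h => isTotallyCyclic_iff_of_reversal (Or.inl h)) hK hA h⟩

theorem ncard_isAcyclic_and_circuitMinimal_and_cocircuitMinimal :
    (({A | (M.reorient A).IsAcyclic ∧ M.CircuitMinimal A ∧ M.CocircuitMinimal A} :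
      Set (Finset E)).ncard : ℤ) = M.tutte 1 0 := by
  have h : ∀ A, ((M.reorient A).IsAcyclic ∧ M.CircuitMinimal A ∧ M.CocircuitMinimal A) ↔
      ((M.reorient A).IsAcyclic ∧ M.CocircuitMinimal A) :=
    fun A => and_congr_right fun h => and_iff_right h.circuitMinimal
  simp only [h, ncard_isAcyclic_and_cocircuitMinimal]

theorem ncard_isTotallyCyclic_and_circuitMinimal_and_cocircuitMinimal :
    (({A | (M.reorient A).IsTotallyCyclic ∧ M.CircuitMinimal A ∧ M.CocircuitMinimal A} :
      Set (Finset E)).ncard : ℤ) = M.tutte 0 1 := by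
  have h : ∀ A, ((M.reorient A).IsTotallyCyclic ∧ M.CircuitMinimal A ∧ M.CocircuitMinimal A) ↔
      ((M.reorient A).IsTotallyCyclic ∧ M.CircuitMinimal A) :=
    fun A => and_congr_right fun h => and_iff_left h.cocircuitMinimal
  simp only [h, ncard_isTotallyCyclic_and_circuitMinimal]

end Classes

end OrientedMatroid

/-! ### The main theorem -/

theorem mainTheorem2 {E : Type*} [Fintype E] [LinearOrder E] (M : OrientedMatroid E) :
    -- circuit-cocircuit reversal classes and `t(M; 1, 1)`
    ((M.circuitCocircuitClasses.ncard : ℤ) ≤ M.tutte 1 1 ∧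
      ((M.circuitCocircuitClasses.ncard : ℤ) = M.tutte 1 1 ↔
        OrientedMatroid.NoTwoInSameClass
          (fun A => M.CircuitMinimal A ∧ M.CocircuitMinimal A) M.circuitCocircuitClasses)) ∧
    -- cocircuit reversal classes and `t(M; 1, 2)`
    ((M.cocircuitClasses.ncard : ℤ) ≤ M.tutte 1 2 ∧
      ((M.cocircuitClasses.ncard : ℤ) = M.tutte 1 2 ↔
        OrientedMatroid.NoTwoInSameClass
          (fun A => M.CocircuitMinimal A) M.cocircuitClasses)) ∧
    -- circuit reversal classes and `t(M; 2, 1)`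
    ((M.circuitClasses.ncard : ℤ) ≤ M.tutte 2 1 ∧
      ((M.circuitClasses.ncard : ℤ) = M.tutte 2 1 ↔
        OrientedMatroid.NoTwoInSameClass
          (fun A => M.CircuitMinimal A) M.circuitClasses)) ∧
    -- acyclic cocircuit reversal classes and `t(M; 1, 0)`
    (((M.acyclicPart M.cocircuitClasses).ncard : ℤ) ≤ M.tutte 1 0 ∧
      (((M.acyclicPart M.cocircuitClasses).ncard : ℤ) = M.tutte 1 0 ↔
        OrientedMatroid.NoTwoInSameClass
          (fun A => (M.reorient A).IsAcyclic ∧ M.CocircuitMinimal A) M.cocircuitClasses)) ∧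
    -- acyclic circuit-cocircuit reversal classes and `t(M; 1, 0)`
    (((M.acyclicPart M.circuitCocircuitClasses).ncard : ℤ) ≤ M.tutte 1 0 ∧
      (((M.acyclicPart M.circuitCocircuitClasses).ncard : ℤ) = M.tutte 1 0 ↔
        OrientedMatroid.NoTwoInSameClass
          (fun A => (M.reorient A).IsAcyclic ∧ M.CircuitMinimal A ∧ M.CocircuitMinimal A)
          M.circuitCocircuitClasses)) ∧
    -- totally cyclic circuit reversal classes and `t(M; 0, 1)`
    (((M.totallyCyclicPart M.circuitClasses).ncard : ℤ) ≤ M.tutte 0 1 ∧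
      (((M.totallyCyclicPart M.circuitClasses).ncard : ℤ) = M.tutte 0 1 ↔
        OrientedMatroid.NoTwoInSameClass
          (fun A => (M.reorient A).IsTotallyCyclic ∧ M.CircuitMinimal A) M.circuitClasses)) ∧
    -- totally cyclic circuit-cocircuit reversal classes and `t(M; 0, 1)`
    (((M.totallyCyclicPart M.circuitCocircuitClasses).ncard : ℤ) ≤ M.tutte 0 1 ∧
      (((M.totallyCyclicPart M.circuitCocircuitClasses).ncard : ℤ) = M.tutte 0 1 ↔
        OrientedMatroid.NoTwoInSameClass
          (fun A => (M.reorient A).IsTotallyCyclic ∧ M.CircuitMinimal A ∧ M.CocircuitMinimal A)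
          M.circuitCocircuitClasses)) := by
  refine ⟨?_, ?_, ?_, ?_, ?_, ?_, ?_⟩
  · exact OrientedMatroid.ncard_classes_le_and_eq_iff _ subset_rfl
      (fun K => M.exists_minimal_mem_circuitCocircuitClasses) (fun K hK _ _ _ => hK)
      M.ncard_circuitMinimal_and_cocircuitMinimal
  · exact OrientedMatroid.ncard_classes_le_and_eq_iff _ subset_rfl
      (fun K => M.exists_minimal_mem_cocircuitClasses) (fun K hK _ _ _ => hK)
      M.ncard_cocircuitMinimal
  · exact OrientedMatroid.ncard_classes_le_and_eq_iff _ subset_rfl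
      (fun K => M.exists_minimal_mem_circuitClasses) (fun K hK _ _ _ => hK)
      M.ncard_circuitMinimal
  · refine OrientedMatroid.ncard_classes_le_and_eq_iff _ (Set.sep_subset _ _) (fun K hK => ?_)
      (fun K hK A hA h => M.mem_acyclicPart_cocircuitClasses hK hA h.1)
      M.ncard_isAcyclic_and_cocircuitMinimal
    obtain ⟨A, hA, h⟩ := M.exists_minimal_mem_cocircuitClasses hK.1
    exact ⟨A, hA, hK.2 A hA, h⟩
  · refine OrientedMatroid.ncard_classes_le_and_eq_iff _ (Set.sep_subset _ _) (fun K hK => ?_)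
      (fun K hK A hA h => M.mem_acyclicPart_circuitCocircuitClasses hK hA h.1)
      M.ncard_isAcyclic_and_circuitMinimal_and_cocircuitMinimal
    obtain ⟨A, hA, h⟩ := M.exists_minimal_mem_circuitCocircuitClasses hK.1
    exact ⟨A, hA, hK.2 A hA, h⟩
  · refine OrientedMatroid.ncard_classes_le_and_eq_iff _ (Set.sep_subset _ _) (fun K hK => ?_)
      (fun K hK A hA h => M.mem_totallyCyclicPart_circuitClasses hK hA h.1)
      M.ncard_isTotallyCyclic_and_circuitMinimal
    obtain ⟨A, hA, h⟩ := M.exists_minimal_mem_circuitClasses hK.1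
    exact ⟨A, hA, hK.2 A hA, h⟩
  · refine OrientedMatroid.ncard_classes_le_and_eq_iff _ (Set.sep_subset _ _) (fun K hK => ?_)
      (fun K hK A hA h => M.mem_totallyCyclicPart_circuitCocircuitClasses hK hA h.1)
      M.ncard_isTotallyCyclic_and_circuitMinimal_and_cocircuitMinimal
    obtain ⟨A, hA, h⟩ := M.exists_minimal_mem_circuitCocircuitClasses hK.1
    exact ⟨A, hA, hK.2 A hA, h⟩
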